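/- Setting. The probe is a spin-$\tfrac12$ particle $\mathrm P$, the target is a qubit $\mathrm S$; $\sigma_x,\sigma_y,\sigma_z$ are the Pauli matrices, $J_i=\sigma_i/2$, $|0\rangle=|\tfrac12,\tfrac12\rangle$, $|1\rangle=|\tfrac12,-\tfrac12\rangle$. Fix $\theta\in[0,2\pi)$. For a unit vector $\mathbf n\in\mathbb R^3$ let $V_{\theta,\mathbf n}=\cos\frac\theta2\,I-i\sin\frac\theta2\,\mathbf n\cdot\boldsymbol\sigma$ and let $|\tfrac12,\tfrac12\rangle_{\mathbf n}$ be the eigenstate of $\mathbf n\cdot\mathbf J$ with eigenvalue $\tfrac12$. For a rotation $g$, represented by $U_g\in SU(2)$, let $V_{\theta,g}=U_gV_\theta U_g^\dagger$ with $V_\theta=V_{\theta,\mathbf e_z}$. Let $d\mathbf n$, $d\psi$, $dg$ be the invariant probability measures on directions, on pure qubit states and on rotations. A channel is a linear, completely positive, trace-preserving map. Problem 1: maximise over all channels $\mathcal C:\mathrm P\otimes\mathrm S\to\mathrm S$ $$F_1(\mathcal C)=\int d\mathbf n\int d\psi\;\langle\psi|V_{\theta,\mathbf n}^\dagger\,\mathcal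 C\big(|\tfrac12,\tfrac12\rangle_{\mathbf n}\langle\tfrac12,\tfrac12|_{\mathbf n}\otimes|\psi\rangle\langle\psi|\big)V_{\theta,\mathbf n}|\psi\rangle .$$ Problem 2: maximise over all finite-dimensional auxiliary systems $\mathrm A$, unit vectors $|\phi\rangle\in\mathrm P\otimes\mathrm A$ and channels $\mathcal C:\mathrm P\otimes\mathrm A\otimes\mathrm S\to\mathrm S$ $$F_2(\mathrm A,\phi,\mathcal C)=\int dg\int d\psi\;\langle\psi|V_{\theta,g}^\dagger\,\mathcal C\big(|\phi_g\rangle\langle\phi_g|\otimes|\psi\rangle\langle\psi|\big)V_{\theta,g}|\psi\rangle,\qquad |\phi_g\rangle=(U_g\otimes I_{\mathrm A})|\phi\rangle .$$ The Heisenberg channel is $\mathcal C_{\rm Hei}(\rho)=\operatorname{Tr}_{\mathrm P}[U_\theta\rho U_\theta^\dagger]$ with $U_\theta=\exp[-\tfrac i2 f(\theta)\sum_iJ_i\otimes\sigma_i]$, where $f(\theta)=\operatorname{arccot}\big[\cot\theta+\tfrac1{2\sin\theta}\big]+s(\theta)$, $\operatorname{arccot}$ has values in $(0,\pi)$, $s=0$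 on $[0,\pi]$, $s=\pi$ on $(\pi,2\pi)$, and, by continuity modulo $2\pi$, $f(0)=0$ and $f(\pi)=\pi$. Let $P_1,P_0$ be the projectors on the subspaces of $\mathrm P\otimes\mathrm S$ with total angular momentum $1$ and $0$, let $$\alpha=\alpha(\theta)=\frac{1+8\cos\theta+9\cos^2\theta}{3(1+2\cos\theta)^2},\quad M_{\rm yes}=\sqrt{1-\tfrac43\alpha}\,P_1+P_0,\quad M_{\rm no}=\sqrt{\tfrac43\alpha}\,P_1,$$ and let $\mathcal C_{\rm UNOT}(\rho)=\int dg\,3\,\langle00|U_g^{\dagger\otimes2}\rho\,U_g^{\otimes2}|00\rangle\,U_g|1\rangle\langle1|U_g^\dagger$ be the 2-to-1 universal NOT. Put $\delta=\arccos\frac{4+\sqrt7}9$. Theorem. (i) If $|\theta-\pi|>\delta$, then $\mathcal C_{\rm Hei}$ is an optimal channel for Problem 1; the probe state $|\tfrac12,\tfrac12\rangle$, with no auxiliary system, together with $\mathcal C_{\rm Hei}$ is an optimal strategy for Problem 2; and both optimal fidelities are equal to $$\frac13+\frac{1+\sqrt{1+8\cos^2\frac\theta2}+4\cos^2\frac\theta2}{12}.$$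 (ii) If $|\theta-\pi|\le\delta$, then the channel $\mathcal C(\rho)=\mathcal C_{\rm Hei}(M_{\rm yes}\rho M_{\rm yes}^\dagger)+\mathcal C_{\rm UNOT}(M_{\rm no}\rho M_{\rm no}^\dagger)$ is optimal for Problem 1; the probe state $|\tfrac12,\tfrac12\rangle$, with no auxiliary system, together with $\mathcal C$ is an optimal strategy for Problem 2; and both optimal fidelities are equal to $$\frac{5-\cos\theta}{12}-\frac{1-\cos\theta}{36(1+2\cos\theta)}.$$ Moreover, in case (ii), $0\le\alpha\le\frac23$, with $\alpha=0$ if and only if $|\theta-\pi|=\delta$ and $\alpha=\frac23$ if and only if $\theta=\pi$; $\alpha$ increases strictly as $|\theta-\pi|$ decreases; $M_{\rm yes}^\dagger M_{\rm yes}+M_{\rm no}^\dagger M_{\rm no}=I$; and if $|\theta-\pi|<\delta$, then the measurement is not projective: neither $M_{\rm yes}^\dagger M_{\rm yes}$ nor $M_{\rm no}^\dagger M_{\rm no}$ is a projector. -/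

import Mathlib

open MeasureTheory Matrix
open scoped Kronecker ComplexOrder

noncomputable section

namespace RotationLearning

/-! ### Qubits, spin operators, and the group of rotations -/

/-- The Pauli matrices `σ_x, σ_y, σ_z`, in the basis `|0⟩ = |1/2,1/2⟩`, `|1⟩ = |1/2,-1/2⟩`. -/
def pauli : Fin 3 → Matrix (Fin 2) (Fin 2) ℂ :=
  ![!![0, 1; 1, 0], !![0, -Complex.I; Complex.I, 0], !![1, 0; 0, -1]]

/-- The spin operators `J_x, J_y, J_z` of a spin-1/2 particle. -/
def spinOp (i : Fin 3) : Matrix (Fin 2) (Fin 2) ℂ := (1 / 2 : ℂ) • pauli i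

/-- `n · σ = n_x σ_x + n_y σ_y + n_z σ_z`. -/
def dotPauli (n : EuclideanSpace ℝ (Fin 3)) : Matrix (Fin 2) (Fin 2) ℂ :=
  ∑ i, (n i : ℂ) • pauli i

/-- `n · J = n_x J_x + n_y J_y + n_z J_z`. -/
def dotSpin (n : EuclideanSpace ℝ (Fin 3)) : Matrix (Fin 2) (Fin 2) ℂ :=
  ∑ i, (n i : ℂ) • spinOp i

/-- The ket `|0⟩ = |1/2,1/2⟩`. -/
def ketUp : Fin 2 → ℂ := ![1, 0]

/-- The ket `|1⟩ = |1/2,-1/2⟩`. -/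
def ketDown : Fin 2 → ℂ := ![0, 1]

/-- The rank-one operator `|φ⟩⟨φ|`. -/
def ketBra {ι : Type*} (φ : ι → ℂ) : Matrix ι ι ℂ := vecMulVec φ (star φ)

/-- The expectation value `⟨ψ|X|ψ⟩`. -/
def expectation {ι : Type*} [Fintype ι] (ψ : ι → ℂ) (X : Matrix ι ι ℂ) : ℂ :=
  star ψ ⬝ᵥ (X *ᵥ ψ)

/-- The group of the unitary matrices `U_g` of determinant one.  It is the double cover of the
rotation group `SO(3)`: the matrices `U` and `-U` stand for the same rotation `g`, and every quantity
averaged below is unchanged under `U ↦ -U`, so that averaging over the Haar measure of this group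
is the same as averaging over the Haar measure of `SO(3)`. -/
abbrev SU2 : Type := Matrix.specialUnitaryGroup (Fin 2) ℂ

instance : MeasurableSpace SU2 := borel SU2

instance : BorelSpace SU2 := ⟨rfl⟩

instance : IsTopologicalGroup SU2 where
  continuous_inv := by
    refine Continuous.subtype_mk (f := fun U : SU2 => star (U : Matrix (Fin 2) (Fin 2) ℂ)) ?_ _
    exact continuous_subtype_val.star

instance : CompactSpace SU2 := by
  refine isCompact_iff_compactSpace.mp ?_
  have hK : IsCompact (Set.univ.pi fun _ : Fin 2 => Set.univ.pi fun _ : Fin 2 =>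
      Metric.closedBall (0 : ℂ) 1) :=
    isCompact_univ_pi fun _ => isCompact_univ_pi fun _ => isCompact_closedBall _ _
  refine IsCompact.of_isClosed_subset (s := (show Set (Matrix (Fin 2) (Fin 2) ℂ) from
    Set.univ.pi fun _ : Fin 2 => Set.univ.pi fun _ : Fin 2 =>
      Metric.closedBall (0 : ℂ) 1)) hK ?_ ?_
  · have h : ((Matrix.specialUnitaryGroup (Fin 2) ℂ : Submonoid (Matrix (Fin 2) (Fin 2) ℂ)) :
        Set (Matrix (Fin 2) (Fin 2) ℂ)) = {A | A * star A = 1} ∩ {A | A.det = 1} := by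
      ext A
      simp [Matrix.mem_specialUnitaryGroup_iff, Matrix.mem_unitaryGroup_iff]
    rw [h]
    refine IsClosed.inter (isClosed_eq ?_ continuous_const) (isClosed_eq ?_ continuous_const)
    · exact continuous_id.mul continuous_id.star
    · exact continuous_id.matrix_det
  · intro A hA i _ j _
    have := entry_norm_bound_of_unitary (Matrix.mem_specialUnitaryGroup_iff.mp hA).1 i j
    simpa using this

/-- The Haar probability measure `dg`. -/
def haar : Measure SU2 := Measure.haarMeasure ⊤

instance : IsProbabilityMeasure haar :=
  ⟨Measure.haarMeasure_self (K₀ := (⊤ : TopologicalSpace.PositiveCompacts SU2))⟩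

/-- The unitarily invariant probability distribution `dψ` on the pure states of a qubit: the law of
the unit vector `U|0⟩`, for `U` distributed according to the Haar measure. -/
def pureStateMeasure : Measure (Fin 2 → ℂ) :=
  haar.map fun U : SU2 => (U : Matrix (Fin 2) (Fin 2) ℂ) *ᵥ ketUp

/-- The rotationally invariant probability distribution `dn` on the unit sphere. -/
def directionMeasure : Measure (Metric.sphere (0 : EuclideanSpace ℝ (Fin 3)) 1) :=
  ((volume : Measure (EuclideanSpace ℝ (Fin 3))).toSphere Set.univ)⁻¹ •
    (volume : Measure (EuclideanSpace ℝ (Fin 3))).toSphere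

/-! ### Quantum channels -/

/-- The extension `Φ ⊗ I` of a map `Φ` to a system with an additional `k`-dimensional factor. -/
def ampliation {ι κ : Type*} (Φ : Matrix ι ι ℂ → Matrix κ κ ℂ) (k : ℕ)
    (X : Matrix (ι × Fin k) (ι × Fin k) ℂ) : Matrix (κ × Fin k) (κ × Fin k) ℂ :=
  Matrix.of fun p q => Φ (Matrix.of fun i j => X (i, p.2) (j, q.2)) p.1 q.1

/-- A quantum channel: a linear, completely positive, trace-preserving map. -/
structure IsChannel {ι κ : Type*} [Fintype ι] [Fintype κ]
    (Φ : Matrix ι ι ℂ → Matrix κ κ ℂ) : Prop where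
  linear : IsLinearMap ℂ Φ
  completelyPositive : ∀ (k : ℕ) (X : Matrix (ι × Fin k) (ι × Fin k) ℂ),
    X.PosSemidef → (ampliation Φ k X).PosSemidef
  tracePreserving : ∀ X : Matrix ι ι ℂ, (Φ X).trace = X.trace

/-! ### The two learning problems for a spin-1/2 probe -/

/-- The rotation `V_{θ,n} = cos(θ/2) I - i sin(θ/2) n·σ` of a qubit. -/
def rotationGate (θ : ℝ) (n : EuclideanSpace ℝ (Fin 3)) : Matrix (Fin 2) (Fin 2) ℂ :=
  (Real.cos (θ / 2) : ℂ) • (1 : Matrix (Fin 2) (Fin 2) ℂ) -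
    (Complex.I * (Real.sin (θ / 2) : ℂ)) • dotPauli n

/-- The rotation `V_θ` about the `z` axis. -/
def rotationGateZ (θ : ℝ) : Matrix (Fin 2) (Fin 2) ℂ :=
  (Real.cos (θ / 2) : ℂ) • (1 : Matrix (Fin 2) (Fin 2) ℂ) -
    (Complex.I * (Real.sin (θ / 2) : ℂ)) • pauli 2

/-- The target gate `V_{θ,g} = U_g V_θ U_g†`. -/
def targetGate (θ : ℝ) (g : SU2) : Matrix (Fin 2) (Fin 2) ℂ :=
  (g : Matrix (Fin 2) (Fin 2) ℂ) * rotationGateZ θ * (g : Matrix (Fin 2) (Fin 2) ℂ)ᴴ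

/-- The state `|1/2,1/2⟩_n ⟨1/2,1/2|_n`; see `ketBra_eq_coherentState`. -/
def coherentState (n : EuclideanSpace ℝ (Fin 3)) : Matrix (Fin 2) (Fin 2) ℂ :=
  (1 / 2 : ℂ) • (1 + dotPauli n)

/-- `coherentState n` is the projector on the eigenstate of `n·J` with eigenvalue `1/2`. -/
theorem ketBra_eq_coherentState (n : EuclideanSpace ℝ (Fin 3))
    (φ : Fin 2 → ℂ) (hφ : star φ ⬝ᵥ φ = 1) (h : dotSpin n *ᵥ φ = (1 / 2 : ℂ) • φ) :
    ketBra φ = coherentState n := by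
  have h0 := congrFun h 0
  have h1 := congrFun h 1
  simp [dotSpin, spinOp, pauli, Matrix.mulVec, dotProduct, Fin.sum_univ_succ] at h0 h1 hφ
  have c0 := congrArg (starRingEnd ℂ) h0
  have c1 := congrArg (starRingEnd ℂ) h1
  simp at c0 c1
  rw [map_ofNat] at c0 c1
  ext i j
  fin_cases i <;> fin_cases j <;>
    simp [ketBra, coherentState, dotPauli, pauli, vecMulVec_apply, Fin.sum_univ_succ]
  all_goals
    generalize (starRingEnd ℂ) (φ 0) = a' at *
    generalize (starRingEnd ℂ) (φ 1) = b' at *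
    generalize φ 0 = a at *
    generalize φ 1 = b at *
    generalize (n.ofLp 0 : ℂ) = x at *
    generalize (n.ofLp 1 : ℂ) = y at *
    generalize (n.ofLp 2 : ℂ) = z at *
  · linear_combination (1 / 2 * (1 + z)) * hφ - a' * h0 + b * c1
  · linear_combination (1 / 2 * (x - y * Complex.I)) * hφ - b' * h0 - a * c1
  · linear_combination (1 / 2 * (x + y * Complex.I)) * hφ - b * c0 - a' * h1
  · linear_combination (1 / 2 * (1 - z)) * hφ - b' * h1 + a * c0

/-- The average input-output fidelity
`∫ dn ∫ dψ ⟨ψ| V_{θ,n}† C(|1/2,1/2⟩_n⟨1/2,1/2|_n ⊗ |ψ⟩⟨ψ|) V_{θ,n} |ψ⟩`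
of a channel `C` that acts on the probe (first factor) and the target (second factor), when the
direction is learnt from a relaxation process. -/
def fidelity₁ (θ : ℝ)
    (C : Matrix (Fin 2 × Fin 2) (Fin 2 × Fin 2) ℂ → Matrix (Fin 2) (Fin 2) ℂ) : ℝ :=
  ∫ n, ∫ ψ, (expectation ψ ((rotationGate θ n)ᴴ * C (coherentState n ⊗ₖ ketBra ψ) *
    rotationGate θ n)).re ∂pureStateMeasure ∂directionMeasure

/-- The average fidelity
`∫ dg ∫ dψ ⟨ψ| V_{θ,g}† C(|φ_g⟩⟨φ_g| ⊗ |ψ⟩⟨ψ|) V_{θ,g} |ψ⟩`, with `|φ_g⟩ = (U_g ⊗ I_A) |φ⟩`,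
of the strategy that prepares the probe and an auxiliary system `A` in the state `|φ⟩` and uses
the channel `C` on probe, auxiliary system and target, when the direction is learnt from the
rotation gate `U_g`. -/
def fidelity₂ {A : Type} [Fintype A] [DecidableEq A] (θ : ℝ) (φ : Fin 2 × A → ℂ)
    (C : Matrix ((Fin 2 × A) × Fin 2) ((Fin 2 × A) × Fin 2) ℂ → Matrix (Fin 2) (Fin 2) ℂ) : ℝ :=
  ∫ g : SU2, ∫ ψ, (expectation ψ ((targetGate θ g)ᴴ *
    C (ketBra (((g : Matrix (Fin 2) (Fin 2) ℂ) ⊗ₖ (1 : Matrix A A ℂ)) *ᵥ φ) ⊗ₖ ketBra ψ) *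
    targetGate θ g)).re ∂pureStateMeasure ∂haar

/-- `C` is an optimal channel for learning from the relaxation process. -/
def IsOptimal₁ (θ : ℝ)
    (C : Matrix (Fin 2 × Fin 2) (Fin 2 × Fin 2) ℂ → Matrix (Fin 2) (Fin 2) ℂ) : Prop :=
  IsChannel C ∧ ∀ C', IsChannel C' → fidelity₁ θ C' ≤ fidelity₁ θ C

/-- The auxiliary system `A`, the input state `|φ⟩` and the channel `C` are an optimal strategy for
learning from the rotation gate: no auxiliary system, input state and channel do better. -/
def IsOptimal₂ {A : Type} [Fintype A] [DecidableEq A] (θ : ℝ) (φ : Fin 2 × A → ℂ)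
    (C : Matrix ((Fin 2 × A) × Fin 2) ((Fin 2 × A) × Fin 2) ℂ → Matrix (Fin 2) (Fin 2) ℂ) :
    Prop :=
  (star φ ⬝ᵥ φ = 1 ∧ IsChannel C) ∧
    ∀ (B : Type) [Fintype B] [DecidableEq B] (φ' : Fin 2 × B → ℂ)
      (C' : Matrix ((Fin 2 × B) × Fin 2) ((Fin 2 × B) × Fin 2) ℂ → Matrix (Fin 2) (Fin 2) ℂ),
      star φ' ⬝ᵥ φ' = 1 → IsChannel C' → fidelity₂ θ φ' C' ≤ fidelity₂ θ φ C

/-- A state of the probe alone, seen as a state of probe and trivial auxiliary system. -/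
def trivialAuxState (φ : Fin 2 → ℂ) : Fin 2 × Unit → ℂ := fun p => φ p.1

/-- A map on probe and target, seen as a map on probe, trivial auxiliary system and target. -/
def trivialAuxMap (C : Matrix (Fin 2 × Fin 2) (Fin 2 × Fin 2) ℂ → Matrix (Fin 2) (Fin 2) ℂ) :
    Matrix ((Fin 2 × Unit) × Fin 2) ((Fin 2 × Unit) × Fin 2) ℂ → Matrix (Fin 2) (Fin 2) ℂ :=
  fun X => C (X.submatrix (fun p => ((p.1, ()), p.2)) (fun p => ((p.1, ()), p.2)))

/-! ### The Heisenberg strategy -/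

/-- The inverse cotangent with values in `(0, π)`. -/
def arccot (x : ℝ) : ℝ := Real.pi / 2 - Real.arctan x

/-- The angle `f(θ) = arccot [cot θ + 1/(2 sin θ)] + s(θ)` for `θ ∈ [0, 2π)`, where `s(θ) = 0` on
`[0, π]` and `s(θ) = π` on `(π, 2π)`.  At the points `θ = 0` and `θ = π`, where `sin θ = 0`, it is
extended by continuity (modulo `2π`), which gives `f(0) = 0` and `f(π) = π`. -/
def heisenbergAngle (θ : ℝ) : ℝ :=
  if Real.sin θ = 0 then θ
  else arccot (Real.cot θ + 1 / (2 * Real.sin θ)) + if θ ≤ Real.pi then 0 else Real.pi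

/-- The Heisenberg coupling `J·σ = ∑ i, J_i ⊗ σ_i` of probe and target. -/
def heisenbergCoupling : Matrix (Fin 2 × Fin 2) (Fin 2 × Fin 2) ℂ :=
  ∑ i, spinOp i ⊗ₖ pauli i

/-- The unitary gate `U_θ = exp[-i f(θ) J·σ/(2j+1)]`, with `2j+1 = 2`. -/
def heisenbergGate (θ : ℝ) : Matrix (Fin 2 × Fin 2) (Fin 2 × Fin 2) ℂ :=
  NormedSpace.exp (-(Complex.I * (heisenbergAngle θ : ℂ) / 2) • heisenbergCoupling)

/-- The partial trace over the probe. -/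
def traceProbe (X : Matrix (Fin 2 × Fin 2) (Fin 2 × Fin 2) ℂ) : Matrix (Fin 2) (Fin 2) ℂ :=
  Matrix.of fun a b => ∑ i, X (i, a) (i, b)

/-- The channel `ρ ↦ Tr_P [U_θ ρ U_θ†]`. -/
def heisenbergChannel (θ : ℝ) (ρ : Matrix (Fin 2 × Fin 2) (Fin 2 × Fin 2) ℂ) :
    Matrix (Fin 2) (Fin 2) ℂ :=
  traceProbe (heisenbergGate θ * ρ * (heisenbergGate θ)ᴴ)

/-! ### The strategy with a measurement and the universal NOT -/

/-- The square `∑ i, (J_i ⊗ I + I ⊗ J_i)²` of the total angular momentum of probe and target, with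
eigenvalue `l(l+1)` on the subspace with total angular momentum `l ∈ {0, 1}`. -/
def totalSpinSq : Matrix (Fin 2 × Fin 2) (Fin 2 × Fin 2) ℂ :=
  ∑ i, (spinOp i ⊗ₖ (1 : Matrix (Fin 2) (Fin 2) ℂ) +
    (1 : Matrix (Fin 2) (Fin 2) ℂ) ⊗ₖ spinOp i) ^ 2

/-- The projector on the subspace with total angular momentum `1`. -/
def proj₁ : Matrix (Fin 2 × Fin 2) (Fin 2 × Fin 2) ℂ := (1 / 2 : ℂ) • totalSpinSq

/-- The projector on the subspace with total angular momentum `0`. -/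
def proj₀ : Matrix (Fin 2 × Fin 2) (Fin 2 × Fin 2) ℂ := 1 - proj₁

/-- `proj₁` and `proj₀` are the spectral projectors of the total angular momentum. -/
theorem proj_spec : proj₁ᴴ = proj₁ ∧ proj₁ * proj₁ = proj₁ ∧
    totalSpinSq * proj₁ = (2 : ℂ) • proj₁ ∧ totalSpinSq * proj₀ = 0 := by
  have hS : totalSpinSq = Matrix.of fun p q => if p.1 = q.1 ∧ p.2 = q.2 then (1:ℂ) + (if p.1 = p.2 then 1 else 0) else if p.1 = q.2 ∧ p.2 = q.1 then 1 else 0 := by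
    ext ⟨a, b⟩ ⟨c, d⟩
    fin_cases a <;> fin_cases b <;> fin_cases c <;> fin_cases d <;> simp [totalSpinSq, spinOp, pauli, pow_two, Matrix.mul_apply, Fin.sum_univ_succ, Fintype.sum_prod_type, Matrix.one_apply, Matrix.add_apply] 
    all_goals try ring_nf
    all_goals try simp [Complex.I_sq]
    all_goals try norm_num
  have h2 : totalSpinSq * totalSpinSq = (2:ℂ) • totalSpinSq := by
    rw [hS]
    ext ⟨a, b⟩ ⟨c, d⟩
    fin_cases a <;> fin_cases b <;> fin_cases c <;> fin_cases d <;> simp [Matrix.mul_apply, Fin.sum_univ_succ, Fintype.sum_prod_type]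
    all_goals norm_num
  have h3 : totalSpinSqᴴ = totalSpinSq := by
    rw [hS]
    ext ⟨a, b⟩ ⟨c, d⟩
    fin_cases a <;> fin_cases b <;> fin_cases c <;> fin_cases d <;> simp
  refine ⟨?_, ?_, ?_, ?_⟩
  · simp [proj₁, h3]
  · simp [proj₁, h2, smul_smul]
  · simp [proj₁, h2, smul_smul]
  · simp [proj₀, proj₁, mul_sub, h2, smul_smul]

/-- The coefficient `α = (1 + 8 cos θ + 9 cos² θ) / (3 (1 + 2 cos θ)²)`. -/
def alpha (θ : ℝ) : ℝ :=
  (1 + 8 * Real.cos θ + 9 * Real.cos θ ^ 2) / (3 * (1 + 2 * Real.cos θ) ^ 2)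

/-- `M_yes = √(1 - 4α/3) P_1 + P_0`. -/
def measYes (θ : ℝ) : Matrix (Fin 2 × Fin 2) (Fin 2 × Fin 2) ℂ :=
  (Real.sqrt (1 - 4 / 3 * alpha θ) : ℂ) • proj₁ + proj₀

/-- `M_no = √(4α/3) P_1`. -/
def measNo (θ : ℝ) : Matrix (Fin 2 × Fin 2) (Fin 2 × Fin 2) ℂ :=
  (Real.sqrt (4 / 3 * alpha θ) : ℂ) • proj₁

/-- The 2-to-1 universal NOT
`ρ ↦ ∫ dg 3 (⟨0|⊗⟨0|) (U_g†)^{⊗2} ρ U_g^{⊗2} (|0⟩⊗|0⟩) U_g |1⟩⟨1| U_g†`. -/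
def universalNot (ρ : Matrix (Fin 2 × Fin 2) (Fin 2 × Fin 2) ℂ) : Matrix (Fin 2) (Fin 2) ℂ :=
  Matrix.of fun a b => ∫ g : SU2,
    3 * expectation (fun p : Fin 2 × Fin 2 => ketUp p.1 * ketUp p.2)
      (((g : Matrix (Fin 2) (Fin 2) ℂ) ⊗ₖ (g : Matrix (Fin 2) (Fin 2) ℂ))ᴴ * ρ *
        ((g : Matrix (Fin 2) (Fin 2) ℂ) ⊗ₖ (g : Matrix (Fin 2) (Fin 2) ℂ))) *
      ((g : Matrix (Fin 2) (Fin 2) ℂ) * ketBra ketDown * (g : Matrix (Fin 2) (Fin 2) ℂ)ᴴ) a b ∂haar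

/-- The strategy that measures `{M_yes, M_no}` on probe and target and then applies the Heisenberg
channel on outcome "yes", and the universal NOT on outcome "no". -/
def measuredChannel (θ : ℝ) (ρ : Matrix (Fin 2 × Fin 2) (Fin 2 × Fin 2) ℂ) :
    Matrix (Fin 2) (Fin 2) ℂ :=
  heisenbergChannel θ (measYes θ * ρ * (measYes θ)ᴴ) +
    universalNot (measNo θ * ρ * (measNo θ)ᴴ)

/-! ### The optimal fidelities -/

/-- The critical distance `δ = arccos [(4 + √7)/9]`. -/
def criticalDistance : ℝ := Real.arccos ((4 + Real.sqrt 7) / 9)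

/-- The fidelity
`1/3 + (1 + √(1 + (2j+1)/j² cos²(θ/2)) + (2j+1)/(2j²) cos²(θ/2)) / (3 (1 + 1/(2j))²)`
at `j = 1/2`. -/
def fidelityFar (θ : ℝ) : ℝ :=
  1 / 3 + (1 + Real.sqrt (1 + 8 * Real.cos (θ / 2) ^ 2) + 4 * Real.cos (θ / 2) ^ 2) / 12

/-- The fidelity `(5 - cos θ)/12 - (1 - cos θ)/(36 (1 + 2 cos θ))`. -/
def fidelityNear (θ : ℝ) : ℝ :=
  (5 - Real.cos θ) / 12 - (1 - Real.cos θ) / (36 * (1 + 2 * Real.cos θ))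

end RotationLearning

end

open RotationLearning

noncomputable section

namespace RotationLearning

/-! The probe state, the gate and its adjoint are each affine in the random direction n, and the
target enters quadratically through |ψ⟩⟨ψ|. So the averages see only the first three moments of n
and the first two moments of the Bloch vector of ψ. These are the same for the uniform measure on
the sphere and for the axis of a Haar-random rotation, which makes the fidelity one linear
functional `averageScore` of the Choi matrix J of the channel.

Write vectors of probe ⊗ target ⊗ output as |p,s,o⟩ and set a_p = ∑_o |p,o,o⟩, b_p = ∑_o |o,p,o⟩.
They span the two copies of spin 1/2 in the triple product (the output transforms by the conjugate
representation), and `overlapA`, `overlapB`, `overlapD` are the entries of the 2×2 compression of J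
to them: A = ∑⟨a_p|J|a_p⟩, B = ∑⟨b_p|J|b_p⟩, D = ∑⟨b_p|J|a_p⟩. For a channel the score is affine in
Re A and Im D. In the basis u_± = a ± b, trace preservation says that the u_- weight (probe and
target in the singlet) is exactly 2, and that the u_+ weight T (triplet) is at most 18, the slack
being the spin-3/2 component. Put c = cos θ and z = (1+2c) + 2i sin θ, so |z|² = 5+4c. The coherence
between u_+ and u_- enters through its component along z, and positivity with a weighted
arithmetic-geometric mean of weight κ > 0 gives the bound `re_averageScore_le`, in which T has
coefficient (1+2c+κ)/4.

If cos θ ≥ -(4+√7)/9, the choice κ = |z|/3 makes that coefficient nonnegative and T = 18 is optimal.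
If cos θ ≤ -(4+√7)/9, the choice κ = -(1+2c) removes T, so it pays to move part of the triplet
weight to spin 3/2. The channel that multiplies the triplet by r, applies the Heisenberg gate and
sends the lost weight to the universal NOT has T = 18r². The angle f(θ) is the argument of z, which
aligns the coherence; r = 1 attains the first bound and r² = 1 - 4α/3 the second.

An auxiliary system does not help. Averaging over rotations about n removes the coherences between
the probe states |0⟩ and |1⟩. The |1⟩ block is a |0⟩ block for the direction -n and the angle -θ,
and both bounds are even in θ; hence the score of any strategy is a convex combination of scores
obeying the bound (`fidelity₂_eq`, `fidelity₂_le`). -/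

/-! ### Isotropic random directions -/

/-- The random vector `n` has the moments of orders one, two and three of a uniformly distributed
direction. -/
structure HasIsotropicMoments {Ω : Type*} [TopologicalSpace Ω] [MeasurableSpace Ω]
    (μ : Measure Ω) (n : Ω → EuclideanSpace ℝ (Fin 3)) : Prop where
  continuous : Continuous n
  first : ∀ i, ∫ ω, n ω i ∂μ = 0
  second : ∀ i j, ∫ ω, n ω i * n ω j ∂μ = if i = j then 1 / 3 else 0
  third : ∀ i j k, ∫ ω, n ω i * n ω j * n ω k ∂μ = 0

/-- A half turn about the `x` axis. -/
def halfTurn (v : EuclideanSpace ℝ (Fin 3)) : EuclideanSpace ℝ (Fin 3) := !₂[v 0, -v 1, -v 2]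

/-- The rotation that permutes the three axes cyclically. -/
def cyclicTurn (v : EuclideanSpace ℝ (Fin 3)) : EuclideanSpace ℝ (Fin 3) := !₂[v 1, v 2, v 0]

theorem HasIsotropicMoments.neg {Ω : Type*} [TopologicalSpace Ω] [MeasurableSpace Ω]
    {μ : Measure Ω} {n : Ω → EuclideanSpace ℝ (Fin 3)} (h : HasIsotropicMoments μ n) :
    HasIsotropicMoments μ fun ω => -n ω where
  continuous := h.continuous.neg
  first i := by simp [integral_neg, h.first]
  second i j := by simpa using h.second i j
  third i j k := by simp [integral_neg, h.third]

section Moments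

variable {Ω : Type*} [TopologicalSpace Ω] [CompactSpace Ω] [MeasurableSpace Ω]
  [OpensMeasurableSpace Ω] {μ : Measure Ω} [IsProbabilityMeasure μ]
  {n : Ω → EuclideanSpace ℝ (Fin 3)}

theorem _root_.Continuous.integrable_of_compactSpace {E : Type*} [NormedAddCommGroup E]
    [SecondCountableTopology E] {f : Ω → E} (hf : Continuous f) : Integrable f μ := by
  obtain ⟨C, hC⟩ := (isCompact_univ (X := Ω)).exists_bound_of_continuousOn hf.continuousOn
  exact Integrable.of_bound hf.aestronglyMeasurable C (Filter.Eventually.of_forall fun x => hC x trivial)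

/-- Three symmetries are enough. Negation kills the odd moments, the half turn kills one mixed
second moment, and the cyclic turn carries this to the other mixed moments and equates the three
squares, whose sum is 1. -/
theorem HasIsotropicMoments.of_invariant (hn : Continuous n) (hu : ∀ ω, ‖n ω‖ = 1)
    (hneg : ∀ f : EuclideanSpace ℝ (Fin 3) → ℝ, Continuous f → ∫ ω, f (n ω) ∂μ = ∫ ω, f (-n ω) ∂μ)
    (hhalf : ∀ f : EuclideanSpace ℝ (Fin 3) → ℝ, Continuous f →
      ∫ ω, f (n ω) ∂μ = ∫ ω, f (halfTurn (n ω)) ∂μ)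
    (hcyc : ∀ f : EuclideanSpace ℝ (Fin 3) → ℝ, Continuous f →
      ∫ ω, f (n ω) ∂μ = ∫ ω, f (cyclicTurn (n ω)) ∂μ) : HasIsotropicMoments μ n := by
  have hc : ∀ i, Continuous fun ω => n ω i := fun i => by fun_prop
  have hodd : ∀ f : EuclideanSpace ℝ (Fin 3) → ℝ, Continuous f → (∀ v, f (-v) = -f v) →
      ∫ ω, f (n ω) ∂μ = 0 := fun f hf ho => by
    have h := hneg f hf
    simp only [ho, integral_neg] at h
    linarith
  have h01 : ∫ ω, n ω 0 * n ω 1 ∂μ = 0 := by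
    have h := hhalf (fun v => v 0 * v 1) (by fun_prop)
    simp [halfTurn, integral_neg] at h
    linarith
  have c01 := hcyc (fun v => v 0 * v 1) (by fun_prop)
  have c12 := hcyc (fun v => v 1 * v 2) (by fun_prop)
  have c00 := hcyc (fun v => v 0 * v 0) (by fun_prop)
  have c11 := hcyc (fun v => v 1 * v 1) (by fun_prop)
  simp [cyclicTurn] at c01 c12 c00 c11
  have hsum : ∫ ω, n ω 0 * n ω 0 ∂μ + ∫ ω, n ω 1 * n ω 1 ∂μ + ∫ ω, n ω 2 * n ω 2 ∂μ = 1 := by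
    rw [← integral_add, ← integral_add]
    · rw [integral_congr_ae (g := fun _ => (1 : ℝ)), integral_const]
      · simp
      · refine Filter.Eventually.of_forall fun ω => ?_
        have h := EuclideanSpace.norm_sq_eq (n ω)
        simp [hu ω, Fin.sum_univ_succ] at h
        simp only []
        linarith
    all_goals exact Continuous.integrable_of_compactSpace (by fun_prop)
  refine ⟨hn, fun i => hodd (fun v => v i) (by fun_prop) (by simp), fun i j => ?_, fun i j k =>
    hodd (fun v => v i * v j * v k) (by fun_prop) (fun v => by simp)⟩
  have h10 : ∫ ω, n ω 1 * n ω 0 ∂μ = 0 := by simpa only [mul_comm] using h01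
  have h12 : ∫ ω, n ω 1 * n ω 2 ∂μ = 0 := by rw [← c01, h01]
  have h20 : ∫ ω, n ω 2 * n ω 0 ∂μ = 0 := by rw [← c12, h12]
  have h21 : ∫ ω, n ω 2 * n ω 1 ∂μ = 0 := by simpa only [mul_comm] using h12
  have h02 : ∫ ω, n ω 0 * n ω 2 ∂μ = 0 := by simpa only [mul_comm] using h20
  fin_cases i <;> fin_cases j <;> simp [h01, h10, h12, h20, h21, h02] <;> linarith

end Moments

/-! ### The uniform distribution on the sphere -/

section Sphere

variable {E : Type*} [NormedAddCommGroup E] [InnerProductSpace ℝ E]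

/-- The action of a linear isometry on the unit sphere. -/
def sphereMap (L : E ≃ₗᵢ[ℝ] E) (x : Metric.sphere (0 : E) 1) : Metric.sphere (0 : E) 1 :=
  ⟨L x, by simp⟩

theorem continuous_sphereMap (L : E ≃ₗᵢ[ℝ] E) : Continuous (sphereMap L) :=
  Continuous.subtype_mk (L.continuous.comp continuous_subtype_val) _

variable [FiniteDimensional ℝ E] [MeasurableSpace E] [BorelSpace E]

-- `toSphere` measures a set by the volume of the cone over it, and a linear isometry maps cones to
-- cones and preserves volume.
open scoped Pointwise in
theorem map_sphereMap_toSphere (L : E ≃ₗᵢ[ℝ] E) :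
    (volume : Measure E).toSphere.map (sphereMap L) = (volume : Measure E).toSphere := by
  ext s hs
  rw [Measure.map_apply (continuous_sphereMap L).measurable hs, Measure.toSphere_apply' _ hs,
    Measure.toSphere_apply' _ ((continuous_sphereMap L).measurable hs)]
  congr 1
  rw [← L.measurePreserving.measure_preimage_equiv (f := L.toMeasurableEquiv)
    (Set.Ioo (0 : ℝ) 1 • (Subtype.val '' s))]
  congr 1
  ext x
  simp only [Set.mem_smul, Set.mem_image, Set.mem_preimage, sphereMap, Subtype.exists]
  constructor
  · rintro ⟨r, hr, _, ⟨y, hy, hys, rfl⟩, rfl⟩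
    exact ⟨r, hr, L y, ⟨L y, by simpa using hy, hys, rfl⟩, by simp⟩
  · rintro ⟨r, hr, _, ⟨y, hy, hys, rfl⟩, hx⟩
    refine ⟨r, hr, L.symm y, ⟨L.symm y, by simpa using hy, by simpa using hys, rfl⟩, ?_⟩
    apply L.injective
    simpa using hx

end Sphere

instance : IsProbabilityMeasure directionMeasure := by
  constructor
  simp only [directionMeasure, Measure.smul_apply, smul_eq_mul]
  refine ENNReal.inv_mul_cancel ?_ (measure_ne_top _ _)
  rw [Measure.measure_univ_ne_zero]
  exact Measure.toSphere_ne_zero _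

theorem integral_sphereMap (L : EuclideanSpace ℝ (Fin 3) ≃ₗᵢ[ℝ] EuclideanSpace ℝ (Fin 3))
    {f : Metric.sphere (0 : EuclideanSpace ℝ (Fin 3)) 1 → ℝ} (hf : Continuous f) :
    ∫ x, f x ∂directionMeasure = ∫ x, f (sphereMap L x) ∂directionMeasure := by
  have h : directionMeasure.map (sphereMap L) = directionMeasure := by
    rw [directionMeasure, Measure.map_smul, map_sphereMap_toSphere]
  conv_lhs => rw [← h]
  exact integral_map (continuous_sphereMap L).aemeasurable hf.aestronglyMeasurable

/-- The half turn about the `x` axis as a linear isometry. -/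
def halfTurnIsometry : EuclideanSpace ℝ (Fin 3) ≃ₗᵢ[ℝ] EuclideanSpace ℝ (Fin 3) :=
  LinearIsometryEquiv.piLpCongrRight 2
    ![LinearIsometryEquiv.refl ℝ ℝ, LinearIsometryEquiv.neg ℝ, LinearIsometryEquiv.neg ℝ]

theorem halfTurnIsometry_apply (v : EuclideanSpace ℝ (Fin 3)) :
    halfTurnIsometry v = halfTurn v := by
  ext i
  fin_cases i <;> simp [halfTurnIsometry, halfTurn]

/-- The cyclic permutation of the axes as a linear isometry. -/
def cyclicTurnIsometry : EuclideanSpace ℝ (Fin 3) ≃ₗᵢ[ℝ] EuclideanSpace ℝ (Fin 3) :=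
  LinearIsometryEquiv.piLpCongrLeft 2 ℝ ℝ (finRotate 3).symm

theorem cyclicTurnIsometry_apply (v : EuclideanSpace ℝ (Fin 3)) :
    cyclicTurnIsometry v = cyclicTurn v := by
  ext i
  fin_cases i <;>
    simp [cyclicTurnIsometry, cyclicTurn, LinearIsometryEquiv.piLpCongrLeft_apply,
      Equiv.piCongrLeft']

theorem hasIsotropicMoments_directionMeasure :
    HasIsotropicMoments directionMeasure Subtype.val := by
  refine .of_invariant continuous_subtype_val (by simp) (fun f hf => ?_) (fun f hf => ?_)
    fun f hf => ?_
  · exact integral_sphereMap (LinearIsometryEquiv.neg ℝ) (f := fun x => f x) (by fun_prop)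
  · simpa only [sphereMap, halfTurnIsometry_apply] using
      integral_sphereMap halfTurnIsometry (f := fun x => f x) (by fun_prop)
  · simpa only [sphereMap, cyclicTurnIsometry_apply] using
      integral_sphereMap cyclicTurnIsometry (f := fun x => f x) (by fun_prop)

/-! ### The Haar measure of `SU(2)` -/

instance : haar.IsHaarMeasure := by unfold haar; infer_instance

/-- A right translate of the Haar measure is again a left-invariant probability measure, so
uniqueness applies. -/
instance : haar.IsMulRightInvariant where
  map_mul_right_eq_self g := by
    have : IsProbabilityMeasure (haar.map (· * g)) :=
      Measure.isProbabilityMeasure_map (by fun_prop)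
    exact Measure.isHaarMeasure_eq_of_isProbabilityMeasure _ _

/-! ### The rotation action of SU(2) on Bloch vectors. -/

/-- The coordinates of a traceless Hermitian matrix in the basis of the Pauli matrices. -/
def blochVector (M : Matrix (Fin 2) (Fin 2) ℂ) : EuclideanSpace ℝ (Fin 3) :=
  !₂[(M 1 0).re, (M 1 0).im, (M 0 0).re]

theorem dotPauli_blochVector {M : Matrix (Fin 2) (Fin 2) ℂ} (hM : Mᴴ = M) (ht : M.trace = 0) :
    dotPauli (blochVector M) = M := by
  have h00 := congrFun₂ hM 0 0
  have h01 := congrFun₂ hM 0 1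
  simp only [conjTranspose_apply] at h00 h01
  have h00' : (M 0 0).im = 0 := Complex.conj_eq_iff_im.mp h00
  rw [trace_fin_two] at ht
  have h11 : M 1 1 = -M 0 0 := by linear_combination ht
  ext i j
  fin_cases i <;> fin_cases j <;>
    simp [dotPauli, blochVector, pauli, Fin.sum_univ_succ, h11, ← h01, Complex.ext_iff, h00']

theorem blochVector_neg (M : Matrix (Fin 2) (Fin 2) ℂ) : blochVector (-M) = -blochVector M := by
  ext i
  fin_cases i <;> simp [blochVector]

theorem dotPauli_mul_self (v : EuclideanSpace ℝ (Fin 3)) :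
    dotPauli v * dotPauli v = ((‖v‖ ^ 2 : ℝ) : ℂ) • 1 := by
  rw [EuclideanSpace.norm_sq_eq]
  ext i j
  fin_cases i <;> fin_cases j <;>
    simp [dotPauli, pauli, Matrix.mul_apply, Fin.sum_univ_succ] <;> ring_nf <;> simp

theorem SU2.mul_conjTranspose (U : SU2) :
    (U : Matrix (Fin 2) (Fin 2) ℂ) * (U : Matrix (Fin 2) (Fin 2) ℂ)ᴴ = 1 :=
  Matrix.mem_unitaryGroup_iff.mp (Matrix.mem_specialUnitaryGroup_iff.mp U.2).1

theorem SU2.conjTranspose_mul (U : SU2) :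
    (U : Matrix (Fin 2) (Fin 2) ℂ)ᴴ * (U : Matrix (Fin 2) (Fin 2) ℂ) = 1 :=
  Matrix.mem_unitaryGroup_iff'.mp (Matrix.mem_specialUnitaryGroup_iff.mp U.2).1

/-- The image `U σ_z U†` of `σ_z` under a rotation. -/
def rotatedZ (U : SU2) : Matrix (Fin 2) (Fin 2) ℂ :=
  (U : Matrix (Fin 2) (Fin 2) ℂ) * pauli 2 * (U : Matrix (Fin 2) (Fin 2) ℂ)ᴴ

/-- The image of the direction of the `z` axis under a rotation. -/
def rotatedAxis (U : SU2) : EuclideanSpace ℝ (Fin 3) := blochVector (rotatedZ U)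

theorem pauli_two_conjTranspose : (pauli 2)ᴴ = pauli 2 := by
  ext i j
  fin_cases i <;> fin_cases j <;> simp [pauli]

theorem dotPauli_rotatedAxis (U : SU2) : dotPauli (rotatedAxis U) = rotatedZ U := by
  refine dotPauli_blochVector ?_ ?_
  · simp [rotatedZ, pauli_two_conjTranspose, Matrix.mul_assoc]
  · rw [rotatedZ, Matrix.trace_mul_cycle, SU2.conjTranspose_mul, Matrix.one_mul]
    simp [pauli, trace_fin_two]

theorem norm_rotatedAxis (U : SU2) : ‖rotatedAxis U‖ = 1 := by
  have h := dotPauli_mul_self (rotatedAxis U)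
  have hz : pauli 2 * pauli 2 = 1 := by
    ext i j
    fin_cases i <;> fin_cases j <;> simp [pauli]
  have h2 : rotatedZ U * rotatedZ U = 1 := by
    rw [rotatedZ, ← Matrix.mul_assoc, ← Matrix.mul_assoc,
      Matrix.mul_assoc _ _ (U : Matrix (Fin 2) (Fin 2) ℂ), SU2.conjTranspose_mul, Matrix.mul_one,
      Matrix.mul_assoc _ (pauli 2) (pauli 2), hz, Matrix.mul_one, SU2.mul_conjTranspose]
  rw [dotPauli_rotatedAxis, h2] at h
  have h3 := congrFun₂ h 0 0
  simp only [one_apply_eq, Matrix.smul_apply, smul_eq_mul, mul_one] at h3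
  have h4 : ‖rotatedAxis U‖ ^ 2 = 1 := by exact_mod_cast h3.symm
  nlinarith [norm_nonneg (rotatedAxis U)]

theorem continuous_coe_SU2 : Continuous fun U : SU2 => (U : Matrix (Fin 2) (Fin 2) ℂ) :=
  continuous_subtype_val

theorem continuous_rotatedZ : Continuous rotatedZ :=
  (continuous_coe_SU2.matrix_mul continuous_const).matrix_mul continuous_coe_SU2.matrix_conjTranspose

theorem continuous_rotatedAxis : Continuous rotatedAxis := by
  have h : ∀ i j, Continuous fun U => rotatedZ U i j := fun i j =>
    continuous_rotatedZ.matrix_elem i j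
  refine (PiLp.continuous_toLp 2 _).comp (continuous_pi fun i => ?_)
  fin_cases i
  · exact Complex.continuous_re.comp (h 1 0)
  · exact Complex.continuous_im.comp (h 1 0)
  · exact Complex.continuous_re.comp (h 0 0)

/-- The half turn `i σ_x` of a spin-1/2 particle. -/
def halfTurnSU2 : SU2 := ⟨!![0, Complex.I; Complex.I, 0], by
  rw [Matrix.mem_specialUnitaryGroup_iff, Matrix.mem_unitaryGroup_iff]
  refine ⟨?_, by simp [det_fin_two]⟩
  ext i j
  fin_cases i <;> fin_cases j <;> simp [Matrix.mul_apply, star_apply]⟩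

/-- The half turn `i σ_z` of a spin-1/2 particle. -/
def halfTurnZ : SU2 := ⟨!![Complex.I, 0; 0, -Complex.I], by
  rw [Matrix.mem_specialUnitaryGroup_iff, Matrix.mem_unitaryGroup_iff]
  refine ⟨?_, by simp [det_fin_two]⟩
  ext i j
  fin_cases i <;> fin_cases j <;> simp [Matrix.mul_apply, star_apply]⟩

/-- The rotation `(1 + i (σ_x + σ_y + σ_z)) / 2` of a spin-1/2 particle, which permutes the axes
cyclically. -/
def cyclicTurnSU2 : SU2 := ⟨(1 / 2 : ℂ) •
    !![1 + Complex.I, 1 + Complex.I; -1 + Complex.I, 1 - Complex.I], by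
  rw [Matrix.mem_specialUnitaryGroup_iff, Matrix.mem_unitaryGroup_iff]
  refine ⟨?_, ?_⟩
  · ext i j
    fin_cases i <;> fin_cases j <;> simp [Matrix.mul_apply, star_apply, Complex.ext_iff] <;> norm_num
  · simp [det_fin_two, Complex.ext_iff]; norm_num⟩

theorem rotatedZ_mul (h U : SU2) : rotatedZ (h * U) =
    (h : Matrix (Fin 2) (Fin 2) ℂ) * dotPauli (rotatedAxis U) *
      (h : Matrix (Fin 2) (Fin 2) ℂ)ᴴ := by
  rw [dotPauli_rotatedAxis]
  simp [rotatedZ, Matrix.mul_assoc]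

theorem rotatedAxis_halfTurn_mul (U : SU2) :
    rotatedAxis (halfTurnSU2 * U) = halfTurn (rotatedAxis U) := by
  rw [rotatedAxis, rotatedZ_mul]
  ext i
  fin_cases i <;>
    simp [blochVector, halfTurn, halfTurnSU2, Matrix.mul_apply, dotPauli, pauli,
      Fin.sum_univ_succ]

theorem rotatedAxis_cyclicTurn_mul (U : SU2) :
    rotatedAxis (cyclicTurnSU2 * U) = cyclicTurn (rotatedAxis U) := by
  rw [rotatedAxis, rotatedZ_mul]
  ext i
  fin_cases i <;>
    simp [blochVector, cyclicTurn, cyclicTurnSU2, Matrix.mul_apply, dotPauli, pauli,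
      Fin.sum_univ_succ] <;> ring

/-- The map n ↦ -n is not a rotation, so left multiplication cannot produce it. Right multiplication
can: it reverses the z axis before U acts. -/
theorem rotatedAxis_mul_halfTurn (U : SU2) :
    rotatedAxis (U * halfTurnSU2) = -rotatedAxis U := by
  have h : (halfTurnSU2 : Matrix (Fin 2) (Fin 2) ℂ) * pauli 2 *
      (halfTurnSU2 : Matrix (Fin 2) (Fin 2) ℂ)ᴴ = -pauli 2 := by
    ext i j
    fin_cases i <;> fin_cases j <;> simp [halfTurnSU2, pauli, Matrix.mul_apply]
  have h2 : rotatedZ (U * halfTurnSU2) = -rotatedZ U := by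
    have : rotatedZ (U * halfTurnSU2) = (U : Matrix (Fin 2) (Fin 2) ℂ) *
        ((halfTurnSU2 : Matrix (Fin 2) (Fin 2) ℂ) * pauli 2 *
          (halfTurnSU2 : Matrix (Fin 2) (Fin 2) ℂ)ᴴ) * (U : Matrix (Fin 2) (Fin 2) ℂ)ᴴ := by
      simp [rotatedZ, Matrix.mul_assoc]
    rw [this, h]
    simp [rotatedZ]
  rw [rotatedAxis, h2, blochVector_neg, rotatedAxis]

theorem hasIsotropicMoments_haar : HasIsotropicMoments haar rotatedAxis := by
  refine .of_invariant continuous_rotatedAxis norm_rotatedAxis (fun f _ => ?_) (fun f _ => ?_)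
    fun f _ => ?_
  · simpa only [rotatedAxis_mul_halfTurn] using
      (integral_mul_right_eq_self (μ := haar) (fun U => f (rotatedAxis U)) halfTurnSU2).symm
  · simpa only [rotatedAxis_halfTurn_mul] using
      (integral_mul_left_eq_self (μ := haar) (fun U => f (rotatedAxis U)) halfTurnSU2).symm
  · simpa only [rotatedAxis_cyclicTurn_mul] using
      (integral_mul_left_eq_self (μ := haar) (fun U => f (rotatedAxis U)) cyclicTurnSU2).symm

/-! ### Moments of the matrix `n · σ` -/

theorem dotPauli_apply (v : EuclideanSpace ℝ (Fin 3)) (a b : Fin 2) :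
    dotPauli v a b = ∑ i, (v i : ℂ) * pauli i a b := by
  simp [dotPauli, Matrix.sum_apply]

theorem dotPauli_conjTranspose (v : EuclideanSpace ℝ (Fin 3)) : (dotPauli v)ᴴ = dotPauli v := by
  ext i j
  fin_cases i <;> fin_cases j <;> simp [dotPauli, pauli, Fin.sum_univ_succ]

/-- The second moments `∫ (n·σ)_{ab} (n·σ)_{cd}` of `n · σ`. -/
def pauliMoment (a b c d : Fin 2) : ℂ :=
  1 / 3 * (2 * ((1 : Matrix (Fin 2) (Fin 2) ℂ) a d * (1 : Matrix (Fin 2) (Fin 2) ℂ) b c) -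
    (1 : Matrix (Fin 2) (Fin 2) ℂ) a b * (1 : Matrix (Fin 2) (Fin 2) ℂ) c d)

/-- The completeness relation of the Pauli matrices; the factor 1/3 is the second moment of a
coordinate of n. -/
theorem sum_pauli_mul_pauli (a b c d : Fin 2) :
    ∑ i, 1 / 3 * (pauli i a b * pauli i c d) = pauliMoment a b c d := by
  fin_cases a <;> fin_cases b <;> fin_cases c <;> fin_cases d <;>
    simp [pauliMoment, pauli, Fin.sum_univ_succ] <;> ring

section Moments

variable {Ω : Type*} [TopologicalSpace Ω] [MeasurableSpace Ω] {μ : Measure Ω}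
  {n : Ω → EuclideanSpace ℝ (Fin 3)}

namespace HasIsotropicMoments

theorem continuous_apply (h : HasIsotropicMoments μ n) (i : Fin 3) :
    Continuous fun ω => (n ω i : ℂ) :=
  Complex.continuous_ofReal.comp ((PiLp.continuous_apply 2 _ i).comp h.continuous)

theorem continuous_dotPauli (h : HasIsotropicMoments μ n) (a b : Fin 2) :
    Continuous fun ω => dotPauli (n ω) a b := by
  simp only [dotPauli_apply]
  exact continuous_finsetSum _ fun i _ => (h.continuous_apply i).mul continuous_const

variable [CompactSpace Ω] [OpensMeasurableSpace Ω] [IsProbabilityMeasure μ]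

theorem integral_sum (h : HasIsotropicMoments μ n) (p : Fin 3 → ℂ) :
    ∫ ω, ∑ i, (n ω i : ℂ) * p i ∂μ = 0 := by
  have hc : ∀ i, Continuous fun ω => (n ω i : ℂ) * p i := fun i =>
    (h.continuous_apply i).mul continuous_const
  rw [integral_finsetSum _ fun i _ => Continuous.integrable_of_compactSpace (hc i)]
  refine Finset.sum_eq_zero fun i _ => ?_
  rw [integral_mul_const, integral_complex_ofReal, h.first]
  simp

theorem integral_sum_mul_sum (h : HasIsotropicMoments μ n) (p q : Fin 3 → ℂ) :
    ∫ ω, (∑ i, (n ω i : ℂ) * p i) * ∑ i, (n ω i : ℂ) * q i ∂μ = ∑ i, 1 / 3 * (p i * q i) := by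
  have hc := h.continuous_apply
  have e : ∀ ω, (∑ i, (n ω i : ℂ) * p i) * ∑ i, (n ω i : ℂ) * q i =
      ∑ i, ∑ j, ((n ω i * n ω j : ℝ) : ℂ) * (p i * q j) := fun ω => by
    rw [Finset.sum_mul_sum]
    exact Finset.sum_congr rfl fun i _ => Finset.sum_congr rfl fun j _ => by push_cast; ring
  have hc2 : ∀ i j, Continuous fun ω => ((n ω i * n ω j : ℝ) : ℂ) * (p i * q j) := fun i j => by
    simp only [Complex.ofReal_mul]
    exact ((hc i).mul (hc j)).mul continuous_const
  simp only [e]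
  rw [integral_finsetSum _ fun i _ =>
    Continuous.integrable_of_compactSpace (continuous_finsetSum _ fun j _ => hc2 i j)]
  refine Finset.sum_congr rfl fun i _ => ?_
  rw [integral_finsetSum _ fun j _ => Continuous.integrable_of_compactSpace (hc2 i j)]
  simp only [integral_mul_const, integral_complex_ofReal, h.second]
  rw [Finset.sum_eq_single i (fun j _ hj => by simp [hj.symm]) (by simp)]
  simp

theorem integral_sum_mul_sum_mul_sum (h : HasIsotropicMoments μ n) (p q r : Fin 3 → ℂ) :
    ∫ ω, (∑ i, (n ω i : ℂ) * p i) * (∑ i, (n ω i : ℂ) * q i) * ∑ i, (n ω i : ℂ) * r i ∂μ = 0 := by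
  have hc := h.continuous_apply
  have e : ∀ ω, (∑ i, (n ω i : ℂ) * p i) * (∑ i, (n ω i : ℂ) * q i) * ∑ i, (n ω i : ℂ) * r i =
      ∑ i, ∑ j, ∑ k, ((n ω i * n ω j * n ω k : ℝ) : ℂ) * (p i * q j * r k) := fun ω => by
    rw [Finset.sum_mul_sum, Finset.sum_mul]
    refine Finset.sum_congr rfl fun i _ => ?_
    rw [Finset.sum_mul_sum]
    exact Finset.sum_congr rfl fun j _ => Finset.sum_congr rfl fun k _ => by push_cast; ring
  have hc3 : ∀ i j k, Continuous fun ω =>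
      ((n ω i * n ω j * n ω k : ℝ) : ℂ) * (p i * q j * r k) := fun i j k => by
    simp only [Complex.ofReal_mul]
    exact (((hc i).mul (hc j)).mul (hc k)).mul continuous_const
  simp only [e]
  rw [integral_finsetSum _ fun i _ => Continuous.integrable_of_compactSpace
    (continuous_finsetSum _ fun j _ => continuous_finsetSum _ fun k _ => hc3 i j k)]
  refine Finset.sum_eq_zero fun i _ => ?_
  rw [integral_finsetSum _ fun j _ => Continuous.integrable_of_compactSpace
    (continuous_finsetSum _ fun k _ => hc3 i j k)]
  refine Finset.sum_eq_zero fun j _ => ?_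
  rw [integral_finsetSum _ fun k _ => Continuous.integrable_of_compactSpace (hc3 i j k)]
  simp only [integral_mul_const, integral_complex_ofReal, h.third]
  simp

theorem integral_dotPauli (h : HasIsotropicMoments μ n) (a b : Fin 2) :
    ∫ ω, dotPauli (n ω) a b ∂μ = 0 := by
  simp only [dotPauli_apply]
  exact h.integral_sum fun i => pauli i a b

theorem integral_dotPauli_mul (h : HasIsotropicMoments μ n) (a b c d : Fin 2) :
    ∫ ω, dotPauli (n ω) a b * dotPauli (n ω) c d ∂μ = pauliMoment a b c d := by
  simp only [dotPauli_apply, ← sum_pauli_mul_pauli]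
  exact h.integral_sum_mul_sum (fun i => pauli i a b) fun i => pauli i c d

theorem integral_dotPauli_mul_mul (h : HasIsotropicMoments μ n) (a b c d e f : Fin 2) :
    ∫ ω, dotPauli (n ω) a b * dotPauli (n ω) c d * dotPauli (n ω) e f ∂μ = 0 := by
  simp only [dotPauli_apply]
  exact h.integral_sum_mul_sum_mul_sum (fun i => pauli i a b) (fun i => pauli i c d)
    fun i => pauli i e f

/-- The average of a product of three affine functions of entries of `n · σ`. -/
theorem integral_affine_mul_mul (h : HasIsotropicMoments μ n)
    (x₀ x₁ y₀ y₁ z₀ z₁ : ℂ) (a b c d e f : Fin 2) :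
    ∫ ω, (x₀ + x₁ * dotPauli (n ω) a b) * (y₀ + y₁ * dotPauli (n ω) c d) *
      (z₀ + z₁ * dotPauli (n ω) e f) ∂μ =
      x₀ * y₀ * z₀ + x₁ * y₁ * z₀ * pauliMoment a b c d + x₁ * y₀ * z₁ * pauliMoment a b e f +
        x₀ * y₁ * z₁ * pauliMoment c d e f := by
  have hab := h.continuous_dotPauli a b
  have hcd := h.continuous_dotPauli c d
  have hef := h.continuous_dotPauli e f
  have e1 : ∀ ω, (x₀ + x₁ * dotPauli (n ω) a b) * (y₀ + y₁ * dotPauli (n ω) c d) *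
      (z₀ + z₁ * dotPauli (n ω) e f) = x₀ * y₀ * z₀ +
      x₁ * y₁ * z₀ * (dotPauli (n ω) a b * dotPauli (n ω) c d) +
      x₁ * y₀ * z₁ * (dotPauli (n ω) a b * dotPauli (n ω) e f) +
      x₀ * y₁ * z₁ * (dotPauli (n ω) c d * dotPauli (n ω) e f) +
      x₁ * y₀ * z₀ * dotPauli (n ω) a b + x₀ * y₁ * z₀ * dotPauli (n ω) c d +
      x₀ * y₀ * z₁ * dotPauli (n ω) e f +
      x₁ * y₁ * z₁ * (dotPauli (n ω) a b * dotPauli (n ω) c d * dotPauli (n ω) e f) :=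
    fun ω => by ring
  simp only [e1]
  rw [integral_add, integral_add, integral_add, integral_add, integral_add, integral_add,
    integral_add]
  · simp only [integral_const_mul, h.integral_dotPauli, h.integral_dotPauli_mul,
      h.integral_dotPauli_mul_mul]
    simp
  all_goals exact Continuous.integrable_of_compactSpace (by fun_prop)

end HasIsotropicMoments

end Moments

/-! ### Average fidelity in terms of the Choi matrix -/

/-- Choi matrices of maps from probe and target to the target. -/
abbrev ChoiMatrix : Type := Matrix ((Fin 2 × Fin 2) × Fin 2) ((Fin 2 × Fin 2) × Fin 2) ℂ

/-- The linear map with a given Choi matrix. -/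
def applyChoi (J : ChoiMatrix) (X : Matrix (Fin 2 × Fin 2) (Fin 2 × Fin 2) ℂ) :
    Matrix (Fin 2) (Fin 2) ℂ :=
  Matrix.of fun a b => ∑ i, ∑ j, X i j * J (i, a) (j, b)

theorem expectation_eq_sum {ι : Type*} [Fintype ι] (ψ : ι → ℂ) (X : Matrix ι ι ℂ) :
    expectation ψ X = ∑ a, ∑ b, X a b * ketBra ψ b a := by
  simp only [expectation, dotProduct, mulVec, Finset.mul_sum, ketBra, vecMulVec_apply]
  exact Finset.sum_congr rfl fun a _ => Finset.sum_congr rfl fun b _ => by ring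

theorem expectation_conj_applyChoi (J : ChoiMatrix) (P V : Matrix (Fin 2) (Fin 2) ℂ)
    (ψ : Fin 2 → ℂ) :
    expectation ψ (Vᴴ * applyChoi J (P ⊗ₖ ketBra ψ) * V) = ∑ i, ∑ j, ∑ a, ∑ b,
      J i j * P i.1.1 j.1.1 * Vᴴ a i.2 * V j.2 b *
        (ketBra ψ i.1.2 j.1.2 * ketBra ψ b a) := by
  rw [expectation_eq_sum]
  simp only [Matrix.mul_apply, applyChoi, Matrix.of_apply, Finset.sum_mul, Finset.mul_sum,
    kroneckerMap_apply]
  simp only [← Fintype.sum_prod_type']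
  -- Both sides are sums over the same six indices; the equivalence only matches their order.
  refine Fintype.sum_equiv
    ⟨fun x => ((x.2.2.2.2.1, x.2.2.2.1), (x.2.2.2.2.2, x.2.2.1), x.1, x.2.1),
      fun y => (y.2.2.1, y.2.2.2, y.2.1.2, y.1.2, y.1.1, y.2.1.1), fun _ => rfl, fun _ => rfl⟩
    _ _ fun x => ?_
  simp only [Equiv.coe_fn_mk]
  ring

theorem ketBra_mulVec {ι κ : Type*} [Fintype ι] (M : Matrix κ ι ℂ) (φ : ι → ℂ) :
    ketBra (M *ᵥ φ) = M * ketBra φ * Mᴴ := by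
  rw [ketBra, ketBra, star_mulVec, ← vecMulVec_mul, mul_vecMulVec]

theorem ketBra_ketUp : ketBra ketUp = (1 / 2 : ℂ) • (1 + pauli 2) := by
  ext i j
  fin_cases i <;> fin_cases j <;> simp [ketBra, ketUp, pauli, vecMulVec_apply]; norm_num

theorem ketBra_ketDown : ketBra ketDown = (1 / 2 : ℂ) • (1 - pauli 2) := by
  ext i j
  fin_cases i <;> fin_cases j <;> simp [ketBra, ketDown, pauli, vecMulVec_apply]; norm_num

theorem conj_ketBra_ketUp (U : SU2) : (U : Matrix (Fin 2) (Fin 2) ℂ) * ketBra ketUp *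
    (U : Matrix (Fin 2) (Fin 2) ℂ)ᴴ = coherentState (rotatedAxis U) := by
  rw [ketBra_ketUp, coherentState, dotPauli_rotatedAxis, rotatedZ]
  simp [Matrix.mul_add, Matrix.add_mul, SU2.mul_conjTranspose]

theorem conj_ketBra_ketDown (U : SU2) : (U : Matrix (Fin 2) (Fin 2) ℂ) * ketBra ketDown *
    (U : Matrix (Fin 2) (Fin 2) ℂ)ᴴ = coherentState (-rotatedAxis U) := by
  have hneg : dotPauli (-rotatedAxis U) = -dotPauli (rotatedAxis U) := by
    simp [dotPauli]
  rw [ketBra_ketDown, coherentState, hneg, dotPauli_rotatedAxis, rotatedZ]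
  simp [Matrix.mul_add, Matrix.add_mul, SU2.mul_conjTranspose,
    sub_eq_add_neg]

theorem coherentState_apply (v : EuclideanSpace ℝ (Fin 3)) (a b : Fin 2) :
    coherentState v a b =
      1 / 2 * (1 : Matrix (Fin 2) (Fin 2) ℂ) a b + 1 / 2 * dotPauli v a b := by
  simp [coherentState]; ring

theorem continuous_coherentState_rotatedAxis (a b : Fin 2) :
    Continuous fun U => coherentState (rotatedAxis U) a b := by
  have := hasIsotropicMoments_haar.continuous_dotPauli a b
  simp only [coherentState_apply]
  fun_prop

theorem integral_coherentState_mul (a b c d : Fin 2) :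
    ∫ U, coherentState (rotatedAxis U) a b * coherentState (rotatedAxis U) c d ∂haar =
      1 / 6 * ((1 : Matrix (Fin 2) (Fin 2) ℂ) a b * (1 : Matrix (Fin 2) (Fin 2) ℂ) c d +
        (1 : Matrix (Fin 2) (Fin 2) ℂ) a d * (1 : Matrix (Fin 2) (Fin 2) ℂ) b c) := by
  -- The third affine factor is the constant 1, so that only second moments remain.
  have h := hasIsotropicMoments_haar.integral_affine_mul_mul
    (1 / 2 * (1 : Matrix (Fin 2) (Fin 2) ℂ) a b) (1 / 2)
    (1 / 2 * (1 : Matrix (Fin 2) (Fin 2) ℂ) c d) (1 / 2) 1 0 a b c d 0 0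
  simp only [zero_mul, add_zero, mul_one, mul_zero] at h
  simp only [coherentState_apply]
  rw [h, pauliMoment]
  ring

/-- The projector on U|0⟩ is the coherent state along the rotated axis, so target averages reduce to
the moments already computed for Haar measure. -/
theorem integral_pureStateMeasure (f : Matrix (Fin 2) (Fin 2) ℂ → ℝ) (hf : Continuous f) :
    ∫ ψ, f (ketBra ψ) ∂pureStateMeasure =
      ∫ U, f (coherentState (rotatedAxis U)) ∂haar := by
  have hk : Continuous fun ψ : Fin 2 → ℂ => ketBra ψ :=
    Continuous.matrix_vecMulVec continuous_id continuous_star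
  rw [pureStateMeasure, integral_map]
  · simp only [ketBra_mulVec, conj_ketBra_ketUp]
  · exact (continuous_coe_SU2.matrix_mulVec continuous_const).aemeasurable
  · exact (hf.comp hk).aestronglyMeasurable

/-- The fidelity for the gate `V` and the probe state `P`, averaged over the target states. -/
def gateScore (J : ChoiMatrix) (P V : Matrix (Fin 2) (Fin 2) ℂ) : ℂ :=
  ∑ i, ∑ j, ∑ a, ∑ b, J i j * P i.1.1 j.1.1 * Vᴴ a i.2 * V j.2 b *
    (1 / 6 * ((1 : Matrix (Fin 2) (Fin 2) ℂ) i.1.2 j.1.2 * (1 : Matrix (Fin 2) (Fin 2) ℂ) b a +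
      (1 : Matrix (Fin 2) (Fin 2) ℂ) i.1.2 a * (1 : Matrix (Fin 2) (Fin 2) ℂ) j.1.2 b))

theorem integral_re_sum {Ω : Type*} [TopologicalSpace Ω] [CompactSpace Ω] [MeasurableSpace Ω]
    [OpensMeasurableSpace Ω] {μ : Measure Ω} [IsProbabilityMeasure μ] {ι : Type*} [Fintype ι]
    (c : ι → ℂ) (f : ι → Ω → ℂ) (hf : ∀ i, Continuous (f i)) :
    ∫ ω, (∑ i, c i * f i ω).re ∂μ = (∑ i, c i * ∫ ω, f i ω ∂μ).re := by
  have hi : ∀ i, Integrable (fun ω => c i * f i ω) μ := fun i =>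
    ((hf i).integrable_of_compactSpace).const_mul _
  have h := integral_re (𝕜 := ℂ) (integrable_finsetSum Finset.univ fun i _ => hi i)
  simp only [RCLike.re_to_complex] at h
  rw [h, integral_finsetSum _ fun i _ => hi i]
  simp only [integral_const_mul]

theorem integral_re_sum₄ {Ω : Type*} [TopologicalSpace Ω] [CompactSpace Ω] [MeasurableSpace Ω]
    [OpensMeasurableSpace Ω] {μ : Measure Ω} [IsProbabilityMeasure μ] {ι κ : Type*} [Fintype ι]
    [Fintype κ] (c : ι → ι → κ → κ → ℂ) (f : ι → ι → κ → κ → Ω → ℂ)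
    (hf : ∀ i j a b, Continuous (f i j a b)) :
    ∫ ω, (∑ i, ∑ j, ∑ a, ∑ b, c i j a b * f i j a b ω).re ∂μ =
      (∑ i, ∑ j, ∑ a, ∑ b, c i j a b * ∫ ω, f i j a b ω ∂μ).re := by
  have h := integral_re_sum (μ := μ) (fun x : ι × ι × κ × κ => c x.1 x.2.1 x.2.2.1 x.2.2.2)
    (fun x => f x.1 x.2.1 x.2.2.1 x.2.2.2) fun x => hf _ _ _ _
  simpa only [Fintype.sum_prod_type] using h

theorem integral_expectation (J : ChoiMatrix) (P V : Matrix (Fin 2) (Fin 2) ℂ) :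
    ∫ ψ, (expectation ψ (Vᴴ * applyChoi J (P ⊗ₖ ketBra ψ) * V)).re ∂pureStateMeasure =
      (gateScore J P V).re := by
  simp only [expectation_conj_applyChoi]
  rw [integral_pureStateMeasure (fun ρ => (∑ i, ∑ j, ∑ a, ∑ b,
      J i j * P i.1.1 j.1.1 * Vᴴ a i.2 * V j.2 b * (ρ i.1.2 j.1.2 * ρ b a)).re)]
  · simp only [gateScore, ← integral_coherentState_mul]
    exact integral_re_sum₄ (fun i j a b => J i j * P i.1.1 j.1.1 * Vᴴ a i.2 * V j.2 b)
      (fun i j a b U => coherentState (rotatedAxis U) i.1.2 j.1.2 *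
        coherentState (rotatedAxis U) b a)
      fun i j a b => (continuous_coherentState_rotatedAxis _ _).mul
        (continuous_coherentState_rotatedAxis _ _)
  · refine Complex.continuous_re.comp ?_
    refine continuous_finsetSum _ fun i _ => continuous_finsetSum _ fun j _ =>
      continuous_finsetSum _ fun a _ => continuous_finsetSum _ fun b _ => ?_
    exact continuous_const.mul ((continuous_id.matrix_elem _ _).mul (continuous_id.matrix_elem _ _))

theorem rotationGate_apply (θ : ℝ) (v : EuclideanSpace ℝ (Fin 3)) (a b : Fin 2) :
    rotationGate θ v a b = (Real.cos (θ / 2) : ℂ) * (1 : Matrix (Fin 2) (Fin 2) ℂ) a b +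
      -(Complex.I * (Real.sin (θ / 2) : ℂ)) * dotPauli v a b := by
  simp [rotationGate, sub_eq_add_neg]

theorem rotationGate_conjTranspose_apply (θ : ℝ) (v : EuclideanSpace ℝ (Fin 3)) (a b : Fin 2) :
    (rotationGate θ v)ᴴ a b = (Real.cos (θ / 2) : ℂ) * (1 : Matrix (Fin 2) (Fin 2) ℂ) a b +
      (Complex.I * (Real.sin (θ / 2) : ℂ)) * dotPauli v a b := by
  rw [rotationGate, conjTranspose_sub, conjTranspose_smul, conjTranspose_smul,
    dotPauli_conjTranspose, conjTranspose_one]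
  simp [-Complex.ofReal_cos, -Complex.ofReal_sin]

/-- The third moments `∫ (|n⟩⟨n|)_{ab} (V_{θ,n}†)_{cd} (V_{θ,n})_{ef}`. -/
def gateMoment (θ : ℝ) (a b c d e f : Fin 2) : ℂ :=
  1 / 2 * (1 : Matrix (Fin 2) (Fin 2) ℂ) a b *
      (Real.cos (θ / 2) * (1 : Matrix (Fin 2) (Fin 2) ℂ) c d) *
      (Real.cos (θ / 2) * (1 : Matrix (Fin 2) (Fin 2) ℂ) e f) +
    1 / 2 * (Complex.I * Real.sin (θ / 2)) *
      (Real.cos (θ / 2) * (1 : Matrix (Fin 2) (Fin 2) ℂ) e f) * pauliMoment a b c d +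
    1 / 2 * (Real.cos (θ / 2) * (1 : Matrix (Fin 2) (Fin 2) ℂ) c d) *
      -(Complex.I * Real.sin (θ / 2)) * pauliMoment a b e f +
    1 / 2 * (1 : Matrix (Fin 2) (Fin 2) ℂ) a b * (Complex.I * Real.sin (θ / 2)) *
      -(Complex.I * Real.sin (θ / 2)) * pauliMoment c d e f

/-- The fidelity averaged over the target states and the directions. -/
def averageScore (θ : ℝ) (J : ChoiMatrix) : ℂ :=
  ∑ i, ∑ j, ∑ a, ∑ b,
    J i j * (1 / 6 * ((1 : Matrix (Fin 2) (Fin 2) ℂ) i.1.2 j.1.2 *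
      (1 : Matrix (Fin 2) (Fin 2) ℂ) b a +
      (1 : Matrix (Fin 2) (Fin 2) ℂ) i.1.2 a * (1 : Matrix (Fin 2) (Fin 2) ℂ) j.1.2 b)) *
      gateMoment θ i.1.1 j.1.1 a i.2 j.2 b

/-- Only isotropy of n is used; this is what lets the sphere, the Haar-random axis and the negative
of that axis share a single score. -/
theorem HasIsotropicMoments.integral_gateScore {Ω : Type*} [TopologicalSpace Ω] [CompactSpace Ω]
    [MeasurableSpace Ω] [OpensMeasurableSpace Ω] {μ : Measure Ω} [IsProbabilityMeasure μ]
    {n : Ω → EuclideanSpace ℝ (Fin 3)} (h : HasIsotropicMoments μ n) (θ : ℝ) (J : ChoiMatrix) :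
    ∫ ω, (gateScore J (coherentState (n ω)) (rotationGate θ (n ω))).re ∂μ =
      (averageScore θ J).re := by
  have hm : ∀ a b c d e f, ∫ ω, coherentState (n ω) a b * (rotationGate θ (n ω))ᴴ c d *
      rotationGate θ (n ω) e f ∂μ = gateMoment θ a b c d e f := fun a b c d e f => by
    simp only [coherentState_apply, rotationGate_apply, rotationGate_conjTranspose_apply]
    exact h.integral_affine_mul_mul _ _ _ _ _ _ a b c d e f
  have hr : ∀ ω, gateScore J (coherentState (n ω)) (rotationGate θ (n ω)) =
      ∑ i, ∑ j, ∑ a, ∑ b,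
      J i j * (1 / 6 * ((1 : Matrix (Fin 2) (Fin 2) ℂ) i.1.2 j.1.2 *
      (1 : Matrix (Fin 2) (Fin 2) ℂ) b a +
      (1 : Matrix (Fin 2) (Fin 2) ℂ) i.1.2 a * (1 : Matrix (Fin 2) (Fin 2) ℂ) j.1.2 b)) *
      (coherentState (n ω) i.1.1 j.1.1 * (rotationGate θ (n ω))ᴴ a i.2 *
        rotationGate θ (n ω) j.2 b) := fun ω => by
    rw [gateScore]
    refine Finset.sum_congr rfl fun i _ => Finset.sum_congr rfl fun j _ =>
      Finset.sum_congr rfl fun a _ => Finset.sum_congr rfl fun b _ => ?_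
    ring
  simp only [hr, averageScore, ← hm]
  refine integral_re_sum₄ (fun i j a b => J i j * (1 / 6 * ((1 : Matrix (Fin 2) (Fin 2) ℂ)
    i.1.2 j.1.2 * (1 : Matrix (Fin 2) (Fin 2) ℂ) b a + (1 : Matrix (Fin 2) (Fin 2) ℂ) i.1.2 a *
      (1 : Matrix (Fin 2) (Fin 2) ℂ) j.1.2 b)))
    (fun i j a b ω => coherentState (n ω) i.1.1 j.1.1 * (rotationGate θ (n ω))ᴴ a i.2 *
        rotationGate θ (n ω) j.2 b) fun i j a b => ?_
  simp only [coherentState_apply, rotationGate_apply, rotationGate_conjTranspose_apply]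
  exact ((continuous_const.add (continuous_const.mul (h.continuous_dotPauli _ _))).mul
    (continuous_const.add (continuous_const.mul (h.continuous_dotPauli _ _)))).mul
    (continuous_const.add (continuous_const.mul (h.continuous_dotPauli _ _)))

/-- The overlap `∑ ⟨p o o|J|p o' o'⟩` of a Choi matrix. -/
def overlapA (J : ChoiMatrix) : ℂ := ∑ p, ∑ a, ∑ b, J ((p, a), a) ((p, b), b)

/-- The overlap `∑ ⟨p s p|J|s o o⟩` of a Choi matrix. -/
def overlapD (J : ChoiMatrix) : ℂ := ∑ p, ∑ s, ∑ a, J ((p, s), p) ((s, a), a)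

/-- The products of half-angle functions collapse to cos θ and sin θ. The sin θ terms are the only
ones correlating the probe with the gate. -/
theorem gateMoment_eq (θ : ℝ) (p p' s o o' s' : Fin 2) :
    gateMoment θ p p' s o o' s' =
    1 / 6 * ((1 + 2 * Real.cos θ) * ((1 : Matrix (Fin 2) (Fin 2) ℂ) p p' *
      (1 : Matrix (Fin 2) (Fin 2) ℂ) s o * (1 : Matrix (Fin 2) (Fin 2) ℂ) o' s') +
    2 * (1 - Real.cos θ) * ((1 : Matrix (Fin 2) (Fin 2) ℂ) p p' *
      (1 : Matrix (Fin 2) (Fin 2) ℂ) s s' * (1 : Matrix (Fin 2) (Fin 2) ℂ) o o') / 2 +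
    Complex.I * Real.sin θ * ((1 : Matrix (Fin 2) (Fin 2) ℂ) o' s' *
      (1 : Matrix (Fin 2) (Fin 2) ℂ) p o * (1 : Matrix (Fin 2) (Fin 2) ℂ) p' s -
      (1 : Matrix (Fin 2) (Fin 2) ℂ) s o * (1 : Matrix (Fin 2) (Fin 2) ℂ) p s' *
      (1 : Matrix (Fin 2) (Fin 2) ℂ) p' o')) := by
  have hc : (Real.cos θ : ℂ) = Real.cos (θ / 2) ^ 2 - Real.sin (θ / 2) ^ 2 := by
    have := Real.cos_two_mul' (θ / 2)
    rw [mul_div_cancel₀ θ two_ne_zero] at this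
    exact_mod_cast this
  have hs : (Real.sin θ : ℂ) = 2 * Real.sin (θ / 2) * Real.cos (θ / 2) := by
    have := Real.sin_two_mul (θ / 2)
    rw [mul_div_cancel₀ θ two_ne_zero] at this
    exact_mod_cast this
  have h1 : (Real.sin (θ / 2) : ℂ) ^ 2 + (Real.cos (θ / 2) : ℂ) ^ 2 = 1 := by
    exact_mod_cast Real.sin_sq_add_cos_sq (θ / 2)
  rw [hc, hs, gateMoment, pauliMoment, pauliMoment, pauliMoment]
  generalize (Real.cos (θ / 2) : ℂ) = c at *
  generalize (Real.sin (θ / 2) : ℂ) = x at *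
  have hc2 : c ^ 2 = 1 - x ^ 2 := by linear_combination h1
  ring_nf
  simp only [Complex.I_sq, hc2]
  ring

/-- Contracting the index deltas leaves, besides the trace, only overlaps of J with a_p = ∑_o
|p,o,o⟩ and b_p = ∑_o |o,p,o⟩. The sum subtracted from `overlapD` is its conjugate when J is
Hermitian. -/
theorem averageScore_eq (θ : ℝ) (J : ChoiMatrix) :
    averageScore θ J = 1 / 12 * J.trace +
      1 / 36 * ((1 + 2 * Real.cos θ) * overlapA J + (1 - Real.cos θ) * J.trace +
        Complex.I * Real.sin θ * (overlapD J - ∑ p, ∑ s, ∑ a, J ((s, a), a) ((p, s), p))) := by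
  simp only [averageScore, gateMoment_eq]
  generalize (Real.cos θ : ℂ) = c
  generalize (Real.sin θ : ℂ) = x
  simp only [trace, diag_apply, overlapA, overlapD, Fintype.sum_prod_type, Fin.sum_univ_two, one_apply_eq,
    one_apply_ne (zero_ne_one : (0 : Fin 2) ≠ 1), one_apply_ne (one_ne_zero : (1 : Fin 2) ≠ 0),
    mul_zero, zero_mul, add_zero, zero_add, mul_one, one_mul, sub_zero, zero_sub]
  ring

/-! ### Upper bounds on the average fidelity -/

/-- `J` is the Choi matrix of a completely positive map that multiplies the trace by `t`. -/
structure IsScaledChoi (t : ℝ) (J : ChoiMatrix) : Prop where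
  posSemidef : J.PosSemidef
  trace : ∀ i j, ∑ a, J (i, a) (j, a) = t * (1 : Matrix (Fin 2 × Fin 2) (Fin 2 × Fin 2) ℂ) i j

/-- The overlap `∑ ⟨o p o|J|o' p o'⟩` of a Choi matrix. -/
def overlapB (J : ChoiMatrix) : ℂ := ∑ p, ∑ a, ∑ b, J ((a, p), a) ((b, p), b)

theorem conj_overlapD {J : ChoiMatrix} (hJ : J.IsHermitian) :
    ∑ p, ∑ s, ∑ a, J ((s, a), a) ((p, s), p) = star (overlapD J) := by
  simp only [overlapD, star_sum, hJ.apply]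

namespace IsScaledChoi

variable {t : ℝ} {J : ChoiMatrix}

theorem trace_eq (h : IsScaledChoi t J) : J.trace = 4 * t := by
  have h1 := fun i => h.trace i i
  simp only [one_apply_eq] at h1
  rw [Matrix.trace, Fintype.sum_prod_type]
  simp only [diag_apply, h1]
  simp

theorem re_averageScore (h : IsScaledChoi t J) (θ : ℝ) : (averageScore θ J).re = t / 3 +
    1 / 36 * ((1 + 2 * Real.cos θ) * (overlapA J).re + 4 * (1 - Real.cos θ) * t -
      2 * Real.sin θ * (overlapD J).im) := by
  have e : averageScore θ J = ((t / 3 + 1 / 36 * (4 * (1 - Real.cos θ) * t -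
      2 * Real.sin θ * (overlapD J).im) : ℝ) : ℂ) +
      ((1 / 36 * (1 + 2 * Real.cos θ) : ℝ) : ℂ) * overlapA J := by
    have hD : overlapD J - star (overlapD J) = (2 * (overlapD J).im : ℝ) * Complex.I :=
      Complex.sub_conj _
    rw [averageScore_eq, conj_overlapD h.posSemidef.isHermitian, h.trace_eq, hD]
    push_cast
    linear_combination (1 / 36 * Complex.sin θ * 2 * (overlapD J).im) * Complex.I_sq
  rw [e, Complex.add_re, Complex.ofReal_re, Complex.re_ofReal_mul]
  ring

theorem re_quadratic_nonneg (h : IsScaledChoi t J) (w : (Fin 2 × Fin 2) × Fin 2 → ℂ) :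
    0 ≤ (∑ i, ∑ j, star (w i) * J i j * w j).re := by
  have h1 := (h.posSemidef.re_dotProduct_nonneg w)
  have e : star w ⬝ᵥ J *ᵥ w = ∑ i, ∑ j, star (w i) * J i j * w j := by
    simp [dotProduct, mulVec, Finset.mul_sum, mul_assoc]
  rw [e] at h1
  exact h1

/-- Positivity of J on the vectors x a_p + y b_p, summed over p: the 2×2 matrix of overlaps is
positive semidefinite. -/
theorem quadratic_overlap_nonneg (h : IsScaledChoi t J) (x y : ℂ) :
    0 ≤ Complex.normSq x * (overlapA J).re + Complex.normSq y * (overlapB J).re +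
      2 * (star y * x * overlapD J).re := by
  have hw := fun p => h.re_quadratic_nonneg fun i =>
    x * (if i.1.1 = p ∧ i.1.2 = i.2 then 1 else 0) + y * if i.1.2 = p ∧ i.1.1 = i.2 then 1 else 0
  have e : ∑ p, (∑ i, ∑ j,
      star (x * (if i.1.1 = p ∧ i.1.2 = i.2 then 1 else 0) +
        y * if i.1.2 = p ∧ i.1.1 = i.2 then 1 else 0) * J i j *
      (x * (if j.1.1 = p ∧ j.1.2 = j.2 then 1 else 0) +
        y * if j.1.2 = p ∧ j.1.1 = j.2 then 1 else 0)) =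
      star x * x * overlapA J + star y * y * overlapB J + star y * x * overlapD J +
        star x * y * ∑ p, ∑ s, ∑ a, J ((s, a), a) ((p, s), p) := by
    simp [Fintype.sum_prod_type, Fin.sum_univ_two, overlapA, overlapB, overlapD]
    ring
  have h2 := add_nonneg (hw 0) (hw 1)
  rw [← Complex.add_re, ← Fin.sum_univ_two (f := fun p => ∑ i, ∑ j,
      star (x * (if i.1.1 = p ∧ i.1.2 = i.2 then 1 else 0) +
        y * if i.1.2 = p ∧ i.1.1 = i.2 then 1 else 0) * J i j *
      (x * (if j.1.1 = p ∧ j.1.2 = j.2 then 1 else 0) +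
        y * if j.1.2 = p ∧ j.1.1 = j.2 then 1 else 0)), e,
    conj_overlapD h.posSemidef.isHermitian] at h2
  simp [Complex.normSq_apply] at h2 ⊢
  linarith

/-- The vector a_p - b_p is, up to sign, (|01⟩ - |10⟩) ⊗ |o⟩ with o ≠ p. Summing over p traces out
the output, and the trace condition gives t times the squared norm 2 of the unnormalised singlet. -/
theorem overlap_singlet (h : IsScaledChoi t J) :
    (overlapA J).re + (overlapB J).re - 2 * (overlapD J).re = 2 * t := by
  have e : overlapA J + overlapB J - overlapD J - star (overlapD J) = 2 * t := by
    rw [← conj_overlapD h.posSemidef.isHermitian]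
    have h1 := h.trace (0, 1) (0, 1)
    have h2 := h.trace (1, 0) (1, 0)
    have h3 := h.trace (0, 1) (1, 0)
    have h4 := h.trace (1, 0) (0, 1)
    simp [Fin.sum_univ_two, one_apply] at h1 h2 h3 h4
    simp only [overlapA, overlapB, overlapD, Fin.sum_univ_two]
    linear_combination h1 + h2 - h3 - h4
  have := congrArg Complex.re e
  simp at this
  linarith

/-- The trace condition gives the triplet total weight 3t. The vectors a_p + b_p have squared norm 6
and span its spin-1/2 part, whence 18t; the deficit is six times the weight on the spin-3/2 part,
which is nonnegative. -/
theorem overlap_triplet_le (h : IsScaledChoi t J) :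
    (overlapA J).re + (overlapB J).re + 2 * (overlapD J).re ≤ 18 * t := by
  -- The four vectors are an orthogonal basis of the spin-3/2 part. Their squared norms are 1, 1, 3,
  -- 3, which explains the weights 6, 6, 2, 2 in `e`.
  have q0 := h.re_quadratic_nonneg fun i => if i = ((0, 0), 1) then 1 else 0
  have q3 := h.re_quadratic_nonneg fun i => if i = ((1, 1), 0) then 1 else 0
  have q1 := h.re_quadratic_nonneg fun i => if i = ((0, 1), 1) then 1 else
    if i = ((1, 0), 1) then 1 else if i = ((0, 0), 0) then -1 else 0
  have q2 := h.re_quadratic_nonneg fun i => if i = ((1, 0), 0) then 1 else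
    if i = ((0, 1), 0) then 1 else if i = ((1, 1), 1) then -1 else 0
  have e : overlapA J + overlapB J + overlapD J + star (overlapD J) + 6 *
      (∑ i, ∑ j, star (if i = (((0 : Fin 2), (0 : Fin 2)), (1 : Fin 2)) then (1 : ℂ) else 0) *
        J i j * (if j = ((0, 0), 1) then 1 else 0)) + 6 *
      (∑ i, ∑ j, star (if i = (((1 : Fin 2), (1 : Fin 2)), (0 : Fin 2)) then (1 : ℂ) else 0) *
        J i j * (if j = ((1, 1), 0) then 1 else 0)) + 2 *
      (∑ i, ∑ j, star (if i = (((0 : Fin 2), (1 : Fin 2)), (1 : Fin 2)) then (1 : ℂ) else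
    if i = ((1, 0), 1) then 1 else if i = ((0, 0), 0) then -1 else 0) *
        J i j * (if j = ((0, 1), 1) then 1 else
    if j = ((1, 0), 1) then 1 else if j = ((0, 0), 0) then -1 else 0)) + 2 *
      (∑ i, ∑ j, star (if i = (((1 : Fin 2), (0 : Fin 2)), (0 : Fin 2)) then (1 : ℂ) else
    if i = ((0, 1), 0) then 1 else if i = ((1, 1), 1) then -1 else 0) *
        J i j * (if j = ((1, 0), 0) then 1 else
    if j = ((0, 1), 0) then 1 else if j = ((1, 1), 1) then -1 else 0)) = 18 * t := by
    rw [← conj_overlapD h.posSemidef.isHermitian]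
    have h1 := h.trace (0, 1) (0, 1)
    have h2 := h.trace (1, 0) (1, 0)
    have h3 := h.trace (0, 1) (1, 0)
    have h4 := h.trace (1, 0) (0, 1)
    have h5 := h.trace (0, 0) (0, 0)
    have h6 := h.trace (1, 1) (1, 1)
    simp [Fin.sum_univ_two, one_apply] at h1 h2 h3 h4 h5 h6
    simp [overlapA, overlapB, overlapD, Fin.sum_univ_two, Fintype.sum_prod_type]
    linear_combination 3 * h1 + 3 * h2 + 3 * h3 + 3 * h4 + 6 * h5 + 6 * h6
  have := congrArg Complex.re e
  rw [Complex.add_re, Complex.add_re, Complex.add_re, Complex.add_re] at this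
  have r6 : ∀ z : ℂ, (6 * z).re = 6 * z.re := fun z => by simp
  have r2 : ∀ z : ℂ, (2 * z).re = 2 * z.re := fun z => by simp
  have r18 : ((18 : ℂ) * t).re = 18 * t := by simp
  simp only [r6, r2, r18, Complex.add_re, Complex.star_def, Complex.conj_re] at this
  simp only [Complex.star_def] at q0 q1 q2 q3
  linarith

/-- The arithmetic-geometric mean inequality for the coherence between a + b and a - b, with free
weight κ. Keeping κ free lets the two regimes of θ be treated by two choices of it. -/
theorem re_averageScore_le (h : IsScaledChoi t J) (θ : ℝ) {κ : ℝ} (hκ : 0 < κ) :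
    36 * (averageScore θ J).re ≤ 12 * t + 4 * (1 - Real.cos θ) * t +
      (1 + 2 * Real.cos θ) * t / 2 + t * (5 + 4 * Real.cos θ) / (2 * κ) +
      (1 + 2 * Real.cos θ + κ) / 4 *
        ((overlapA J).re + (overlapB J).re + 2 * (overlapD J).re) := by
  rw [h.re_averageScore]
  have hτ := Real.sq_sqrt hκ.le
  have hτ0 := Real.sqrt_pos.mpr hκ
  set τ := √κ
  -- The test vector is τ(a + b) - (z/τ)(a - b) with z = 1 + 2cos θ + 2i sin θ and τ² = κ. A quarter
  -- of its quadratic form is exactly the gap in the claimed inequality.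
  have hq := h.quadratic_overlap_nonneg (τ - ⟨(1 + 2 * Real.cos θ) / τ, 2 * Real.sin θ / τ⟩)
    (τ + ⟨(1 + 2 * Real.cos θ) / τ, 2 * Real.sin θ / τ⟩)
  have hs := h.overlap_singlet
  have hcs := Real.sin_sq_add_cos_sq θ
  simp [Complex.normSq_apply] at hq
  rw [← hτ]
  generalize (overlapA J).re = A at *
  generalize (overlapB J).re = B at *
  generalize (overlapD J).re = D at *
  generalize (overlapD J).im = E at *
  have hB : B = 2 * t - A + 2 * D := by linarith
  have ht : t * (5 + 4 * Real.cos θ) / (2 * τ ^ 2) =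
      t * ((1 + 2 * Real.cos θ) ^ 2 + (2 * Real.sin θ) ^ 2) / (2 * τ ^ 2) := by
    congr 2
    linear_combination (-4) * hcs
  rw [ht]
  subst hB
  refine le_of_sub_nonneg (le_of_le_of_eq (mul_nonneg (by norm_num : (0 : ℝ) ≤ 1 / 4) hq) ?_)
  field_simp
  ring

theorem re_averageScore_le_fidelityFar (h : IsScaledChoi t J) {θ : ℝ}
    (hθ : -((4 + √7) / 9) ≤ Real.cos θ) : (averageScore θ J).re ≤ t * fidelityFar θ := by
  have hR : 0 ≤ 5 + 4 * Real.cos θ := by linarith [Real.neg_one_le_cos θ]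
  have hc : Real.cos (θ / 2) ^ 2 = (1 + Real.cos θ) / 2 := by
    rw [Real.cos_sq, mul_div_cancel₀ θ two_ne_zero]; ring
  have hR2 := Real.sq_sqrt hR
  have hRpos : 0 < √(5 + 4 * Real.cos θ) :=
    Real.sqrt_pos.mpr (by linarith [Real.neg_one_le_cos θ])
  have hcoef : 0 ≤ 1 + 2 * Real.cos θ + √(5 + 4 * Real.cos θ) / 3 := by
    by_cases h1 : 0 ≤ 1 + 2 * Real.cos θ
    · positivity
    · have h7 := Real.sq_sqrt (by norm_num : (0 : ℝ) ≤ 7)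
      -- Squared, this reads 9cos²θ + 8cos θ + 1 ≤ 0, whose smaller root is -(4+√7)/9; the same
      -- quadratic is the numerator of `alpha`.
      have : -3 * (1 + 2 * Real.cos θ) ≤ √(5 + 4 * Real.cos θ) :=
        Real.le_sqrt_of_sq_le (by nlinarith)
      linarith
  -- This κ minimises κT/4 + t(5 + 4cos θ)/(2κ) at the maximal triplet weight T = 18t.
  have hb := h.re_averageScore_le θ (κ := √(5 + 4 * Real.cos θ) / 3) (by positivity)
  have hm := mul_le_mul_of_nonneg_left h.overlap_triplet_le
    (by linarith : 0 ≤ (1 + 2 * Real.cos θ + √(5 + 4 * Real.cos θ) / 3) / 4)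
  have hd : t * (5 + 4 * Real.cos θ) / (2 * (√(5 + 4 * Real.cos θ) / 3)) =
      3 / 2 * t * √(5 + 4 * Real.cos θ) := by
    rw [div_eq_iff (by positivity)]
    linear_combination (-t) * hR2
  rw [hd] at hb
  rw [fidelityFar, hc, show 1 + 8 * ((1 + Real.cos θ) / 2) = 5 + 4 * Real.cos θ by ring]
  linarith

theorem re_averageScore_le_fidelityNear (h : IsScaledChoi t J) {θ : ℝ}
    (hθ : Real.cos θ ≤ -((4 + √7) / 9)) : (averageScore θ J).re ≤ t * fidelityNear θ := by
  have h7 : 2 ≤ √7 := Real.le_sqrt_of_sq_le (by norm_num)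
  have hneg : 1 + 2 * Real.cos θ < 0 := by linarith
  -- With this κ the coefficient of the triplet weight vanishes, so no bound on that weight is
  -- needed.
  have hb := h.re_averageScore_le θ (κ := -(1 + 2 * Real.cos θ)) (by linarith)
  rw [fidelityNear]
  refine le_of_mul_le_mul_left (hb.trans (le_of_eq ?_)) (by norm_num : (0 : ℝ) < 36)
  have hne : 1 + 2 * Real.cos θ ≠ 0 := hneg.ne
  rw [add_neg_cancel, mul_neg, div_neg]
  clear hb h7 hneg hθ
  generalize hu : 1 + 2 * Real.cos θ = u at *
  have hc : Real.cos θ = (u - 1) / 2 := by linarith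
  rw [hc]
  field_simp
  ring

end IsScaledChoi

/-! ### Reduction of the two learning problems to Choi matrices -/

/-- Stated for an arbitrary family of vectors x, so that it serves both the ordinary Choi matrix and
the blocks `auxChoi`, whose vectors carry the auxiliary state. -/
theorem IsChannel.choi_posSemidef {ι : Type*} [Fintype ι]
    {C : Matrix ι ι ℂ → Matrix (Fin 2) (Fin 2) ℂ} (hC : IsChannel C)
    (x : Fin 2 × Fin 2 → ι → ℂ) :
    (Matrix.of fun i j : (Fin 2 × Fin 2) × Fin 2 =>
      C (vecMulVec (x i.1) (star (x j.1))) i.2 j.2).PosSemidef := by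
  let e : Fin 2 × Fin 2 ≃ Fin 4 := finProdFinEquiv
  -- Complete positivity is applied to the projector on ∑ x_i ⊗ |i⟩, with a four-dimensional
  -- reference system labelling the family.
  have h := hC.completelyPositive 4 (ketBra fun q => x (e.symm q.2) q.1)
    (posSemidef_vecMulVec_self_star _)
  have h2 := h.submatrix fun i : (Fin 2 × Fin 2) × Fin 2 => (i.2, e i.1)
  convert h2 using 1
  ext i j
  simp only [Matrix.of_apply, submatrix_apply, ampliation, ketBra]
  congr 1
  ext q q'
  simp [vecMulVec_apply]

theorem IsChannel.choi_trace {ι : Type*} [Fintype ι]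
    {C : Matrix ι ι ℂ → Matrix (Fin 2) (Fin 2) ℂ} (hC : IsChannel C) (x y : ι → ℂ) :
    ∑ a, C (vecMulVec x (star y)) a a = ∑ q, x q * star (y q) := by
  have h := hC.tracePreserving (vecMulVec x (star y))
  simpa [Matrix.trace, diag_apply, vecMulVec_apply] using h

/-- The Choi matrix of a map from probe and target to the target. -/
def choi (C : Matrix (Fin 2 × Fin 2) (Fin 2 × Fin 2) ℂ → Matrix (Fin 2) (Fin 2) ℂ) : ChoiMatrix :=
  Matrix.of fun i j => C (vecMulVec (Pi.single i.1 1) (star (Pi.single j.1 1))) i.2 j.2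

theorem IsChannel.isScaledChoi
    {C : Matrix (Fin 2 × Fin 2) (Fin 2 × Fin 2) ℂ → Matrix (Fin 2) (Fin 2) ℂ}
    (hC : IsChannel C) : IsScaledChoi 1 (choi C) where
  posSemidef := hC.choi_posSemidef fun i => Pi.single i 1
  trace i j := by
    simp only [choi, of_apply, hC.choi_trace]
    simp [Pi.single_apply, one_apply, eq_comm]

theorem sum_mul_single_mul_single {ι : Type*} [Fintype ι] [DecidableEq ι] (M : Matrix ι ι ℂ)
    (x y : ι) (c d : ℂ) :
    ∑ i, ∑ j, M i j * ((Pi.single i 1 : ι → ℂ) x * c * star ((Pi.single j 1 : ι → ℂ) y * d)) =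
      M x y * (c * star d) := by
  rw [Finset.sum_eq_single x, Finset.sum_eq_single y]
  · simp
  · intro j _ hj
    simp [Pi.single_eq_of_ne hj.symm]
  · simp
  · intro i _ hi
    simp [Pi.single_eq_of_ne hi.symm]
  · simp

theorem applyChoi_choi
    {C : Matrix (Fin 2 × Fin 2) (Fin 2 × Fin 2) ℂ → Matrix (Fin 2) (Fin 2) ℂ}
    (hC : IsLinearMap ℂ C) (X : Matrix (Fin 2 × Fin 2) (Fin 2 × Fin 2) ℂ) :
    applyChoi (choi C) X = C X := by
  have hX : X = ∑ i, ∑ j, X i j • vecMulVec (Pi.single i 1) (star (Pi.single j 1)) := by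
    ext i j
    have h := sum_mul_single_mul_single X i j 1 1
    simp only [mul_one, star_one] at h
    simp only [Matrix.sum_apply, Matrix.smul_apply, smul_eq_mul, vecMulVec_apply, Pi.star_apply, h]
  have hL : ∀ Y, C Y = hC.mk' C Y := fun _ => rfl
  conv_rhs => rw [hX, hL]
  simp only [map_sum, map_smul, IsLinearMap.mk'_apply]
  ext a b
  simp only [Matrix.sum_apply, applyChoi, of_apply, choi, Matrix.smul_apply, smul_eq_mul]

theorem fidelity₁_eq (θ : ℝ)
    {C : Matrix (Fin 2 × Fin 2) (Fin 2 × Fin 2) ℂ → Matrix (Fin 2) (Fin 2) ℂ}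
    (hC : IsLinearMap ℂ C) : fidelity₁ θ C = (averageScore θ (choi C)).re := by
  simp only [fidelity₁, ← applyChoi_choi hC, integral_expectation]
  exact hasIsotropicMoments_directionMeasure.integral_gateScore θ (choi C)

section Auxiliary

variable {A : Type} [Fintype A]

/-- The Choi matrix of the block `⟨r|·|r'⟩` of a strategy with auxiliary system, where the
auxiliary system is left by the probe state `|r⟩` in the state `|φ_r⟩`. -/
def auxChoi (φ : Fin 2 × A → ℂ)
    (C : Matrix ((Fin 2 × A) × Fin 2) ((Fin 2 × A) × Fin 2) ℂ → Matrix (Fin 2) (Fin 2) ℂ)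
    (r r' : Fin 2) : ChoiMatrix :=
  Matrix.of fun i j => C (vecMulVec
    (fun q => (Pi.single i.1 1 : Fin 2 × Fin 2 → ℂ) (q.1.1, q.2) * φ (r, q.1.2))
    (star fun q => (Pi.single j.1 1 : Fin 2 × Fin 2 → ℂ) (q.1.1, q.2) * φ (r', q.1.2))) i.2 j.2

/-- With the auxiliary system fixed in the unnormalised state φ_r, the channel becomes a completely
positive map on probe and target that scales the trace by ‖φ_r‖². -/
theorem IsChannel.isScaledChoi_auxChoi (φ : Fin 2 × A → ℂ)
    {C : Matrix ((Fin 2 × A) × Fin 2) ((Fin 2 × A) × Fin 2) ℂ → Matrix (Fin 2) (Fin 2) ℂ}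
    (hC : IsChannel C) (r : Fin 2) :
    IsScaledChoi (∑ a, Complex.normSq (φ (r, a))) (auxChoi φ C r r) where
  posSemidef := hC.choi_posSemidef fun i q =>
    (Pi.single i 1 : Fin 2 × Fin 2 → ℂ) (q.1.1, q.2) * φ (r, q.1.2)
  trace i j := by
    simp only [auxChoi, of_apply, hC.choi_trace]
    have e : ∀ i j : Fin 2 × Fin 2, ∀ q : (Fin 2 × A) × Fin 2,
        (Pi.single i 1 : Fin 2 × Fin 2 → ℂ) (q.1.1, q.2) * φ (r, q.1.2) *
        star ((Pi.single j 1 : Fin 2 × Fin 2 → ℂ) (q.1.1, q.2) * φ (r, q.1.2)) =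
        Complex.normSq (φ (r, q.1.2)) * ((Pi.single i 1 : Fin 2 × Fin 2 → ℂ) (q.1.1, q.2) *
          (Pi.single j 1 : Fin 2 × Fin 2 → ℂ) (q.1.1, q.2)) := fun i j q => by
      rw [← Complex.mul_conj]
      simp only [Pi.single_apply, star_mul', Complex.star_def]
      split_ifs <;> simp
    simp only [e, Fintype.sum_prod_type]
    rw [Complex.ofReal_sum, Finset.sum_mul, Finset.sum_comm]
    refine Finset.sum_congr rfl fun a _ => ?_
    simp only [← Finset.mul_sum]
    rw [← Fintype.sum_prod_type' (f := fun p s => (Pi.single i 1 : Fin 2 × Fin 2 → ℂ) (p, s) *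
          (Pi.single j 1 : Fin 2 × Fin 2 → ℂ) (p, s))]
    simp [Pi.single_apply, one_apply, eq_comm]

/-- Since φ = ∑ |r⟩ ⊗ φ_r and U acts on the probe alone, the auxiliary system can be absorbed into
four maps on probe and target. -/
theorem map_ketBra_kronecker [DecidableEq A] (φ : Fin 2 × A → ℂ)
    {C : Matrix ((Fin 2 × A) × Fin 2) ((Fin 2 × A) × Fin 2) ℂ → Matrix (Fin 2) (Fin 2) ℂ}
    (hC : IsLinearMap ℂ C) (U ρ : Matrix (Fin 2) (Fin 2) ℂ) :
    C (ketBra ((U ⊗ₖ (1 : Matrix A A ℂ)) *ᵥ φ) ⊗ₖ ρ) =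
      ∑ r, ∑ r', applyChoi (auxChoi φ C r r') ((U * single r r' 1 * Uᴴ) ⊗ₖ ρ) := by
  have hX : ketBra ((U ⊗ₖ (1 : Matrix A A ℂ)) *ᵥ φ) ⊗ₖ ρ =
      ∑ r, ∑ r', ∑ i, ∑ j, ((U * single r r' 1 * Uᴴ) ⊗ₖ ρ) i j • vecMulVec
    (fun q : (Fin 2 × A) × Fin 2 =>
      (Pi.single i 1 : Fin 2 × Fin 2 → ℂ) (q.1.1, q.2) * φ (r, q.1.2))
    (star fun q : (Fin 2 × A) × Fin 2 =>
      (Pi.single j 1 : Fin 2 × Fin 2 → ℂ) (q.1.1, q.2) * φ (r', q.1.2)) := by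
    ext ⟨⟨p, a⟩, s⟩ ⟨⟨p', a'⟩, s'⟩
    have hφ : ∀ p a, ((U ⊗ₖ (1 : Matrix A A ℂ)) *ᵥ φ) (p, a) = ∑ r, U p r * φ (r, a) := fun p a => by
      simp [mulVec, dotProduct, Fintype.sum_prod_type, kroneckerMap_apply, one_apply]
    simp only [Matrix.sum_apply, Matrix.smul_apply, smul_eq_mul, vecMulVec_apply, Pi.star_apply,
      sum_mul_single_mul_single]
    simp only [kroneckerMap_apply, ketBra, vecMulVec_apply, Pi.star_apply, hφ]
    simp [Fin.sum_univ_two, Matrix.mul_apply, single_apply]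
    ring
  have hL : ∀ Y, C Y = hC.mk' C Y := fun _ => rfl
  rw [hX, hL]
  simp only [map_sum, map_smul, IsLinearMap.mk'_apply]
  ext a b
  simp only [Matrix.sum_apply, applyChoi, of_apply, auxChoi, Matrix.smul_apply, smul_eq_mul]

end Auxiliary

/-! ### The learning problem with an auxiliary system -/

theorem integrable_pureStateMeasure {f : (Fin 2 → ℂ) → ℝ} (hf : Continuous f) :
    Integrable f pureStateMeasure := by
  have hm : Continuous fun U : SU2 => (U : Matrix (Fin 2) (Fin 2) ℂ) *ᵥ ketUp :=
    continuous_coe_SU2.matrix_mulVec continuous_const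
  rw [pureStateMeasure, integrable_map_measure hf.aestronglyMeasurable hm.aemeasurable]
  exact (hf.comp hm).integrable_of_compactSpace

theorem continuous_expectation (J : ChoiMatrix) (P V : Matrix (Fin 2) (Fin 2) ℂ) :
    Continuous fun ψ => (expectation ψ (Vᴴ * applyChoi J (P ⊗ₖ ketBra ψ) * V)).re := by
  have hk : Continuous fun ψ : Fin 2 → ℂ => ketBra ψ :=
    Continuous.matrix_vecMulVec continuous_id continuous_star
  simp only [expectation_conj_applyChoi]
  exact Complex.continuous_re.comp <| continuous_finsetSum _ fun i _ =>
    continuous_finsetSum _ fun j _ => continuous_finsetSum _ fun a _ =>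
      continuous_finsetSum _ fun b _ =>
        continuous_const.mul ((hk.matrix_elem _ _).mul (hk.matrix_elem _ _))

theorem continuous_gateScore (J : ChoiMatrix) {Ω : Type*} [TopologicalSpace Ω]
    {P V : Ω → Matrix (Fin 2) (Fin 2) ℂ} (hP : Continuous P) (hV : Continuous V) :
    Continuous fun ω => (gateScore J (P ω) (V ω)).re := by
  exact Complex.continuous_re.comp <| continuous_finsetSum _ fun i _ =>
    continuous_finsetSum _ fun j _ => continuous_finsetSum _ fun a _ =>
      continuous_finsetSum _ fun b _ =>
        (((continuous_const.mul (hP.matrix_elem _ _)).mul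
          (hV.matrix_conjTranspose.matrix_elem _ _)).mul (hV.matrix_elem _ _)).mul continuous_const

theorem expectation_sum {ι κ : Type*} [Fintype ι] (s : Finset κ) (ψ : ι → ℂ)
    (X : κ → Matrix ι ι ℂ) : expectation ψ (∑ k ∈ s, X k) = ∑ k ∈ s, expectation ψ (X k) := by
  simp [expectation, Matrix.sum_mulVec, dotProduct_sum]

theorem gateScore_neg (J : ChoiMatrix) (P V : Matrix (Fin 2) (Fin 2) ℂ) :
    gateScore J (-P) V = -gateScore J P V := by
  simp only [gateScore, Matrix.neg_apply, mul_neg, neg_mul, Finset.sum_neg_distrib]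

theorem targetGate_eq (θ : ℝ) (U : SU2) : targetGate θ U = rotationGate θ (rotatedAxis U) := by
  rw [rotationGate, dotPauli_rotatedAxis, targetGate, rotationGateZ, rotatedZ]
  simp [Matrix.mul_sub, Matrix.sub_mul, SU2.mul_conjTranspose]

theorem rotationGate_neg_neg (θ : ℝ) (v : EuclideanSpace ℝ (Fin 3)) :
    rotationGate (-θ) (-v) = rotationGate θ v := by
  have hneg : dotPauli (-v) = -dotPauli v := by simp [dotPauli]
  rw [rotationGate, rotationGate, hneg, neg_div, Real.cos_neg, Real.sin_neg]
  simp

theorem rotatedAxis_mul_halfTurnZ (U : SU2) : rotatedAxis (U * halfTurnZ) = rotatedAxis U := by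
  have h : (halfTurnZ : Matrix (Fin 2) (Fin 2) ℂ) * pauli 2 *
      (halfTurnZ : Matrix (Fin 2) (Fin 2) ℂ)ᴴ = pauli 2 := by
    ext i j
    fin_cases i <;> fin_cases j <;> simp [halfTurnZ, pauli, Matrix.mul_apply]
  have h2 : rotatedZ (U * halfTurnZ) = (U : Matrix (Fin 2) (Fin 2) ℂ) *
      ((halfTurnZ : Matrix (Fin 2) (Fin 2) ℂ) * pauli 2 *
        (halfTurnZ : Matrix (Fin 2) (Fin 2) ℂ)ᴴ) * (U : Matrix (Fin 2) (Fin 2) ℂ)ᴴ := by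
    simp [rotatedZ, Matrix.mul_assoc]
  rw [rotatedAxis, h2, h, rotatedAxis, rotatedZ]

/-- A half turn about z leaves the axis and the gate unchanged but gives |0⟩ and |1⟩ opposite
phases. This sign makes the coherence terms average to zero. -/
theorem conj_single_mul_halfTurnZ (U : SU2) {r r' : Fin 2} (hr : r ≠ r') :
    ((U * halfTurnZ : SU2) : Matrix (Fin 2) (Fin 2) ℂ) * single r r' 1 *
      ((U * halfTurnZ : SU2) : Matrix (Fin 2) (Fin 2) ℂ)ᴴ =
    -((U : Matrix (Fin 2) (Fin 2) ℂ) * single r r' 1 * (U : Matrix (Fin 2) (Fin 2) ℂ)ᴴ) := by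
  have h : (halfTurnZ : Matrix (Fin 2) (Fin 2) ℂ) * single r r' 1 *
      (halfTurnZ : Matrix (Fin 2) (Fin 2) ℂ)ᴴ = -single r r' 1 := by
    ext i j
    fin_cases r <;> fin_cases r' <;> first | exact absurd rfl hr | skip
    all_goals fin_cases i <;> fin_cases j <;>
      simp [halfTurnZ, Matrix.mul_apply, vecMul, dotProduct, Fin.sum_univ_two]
  have h2 : ((U * halfTurnZ : SU2) : Matrix (Fin 2) (Fin 2) ℂ) * single r r' 1 *
      ((U * halfTurnZ : SU2) : Matrix (Fin 2) (Fin 2) ℂ)ᴴ = (U : Matrix (Fin 2) (Fin 2) ℂ) *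
      ((halfTurnZ : Matrix (Fin 2) (Fin 2) ℂ) * single r r' 1 *
        (halfTurnZ : Matrix (Fin 2) (Fin 2) ℂ)ᴴ) * (U : Matrix (Fin 2) (Fin 2) ℂ)ᴴ := by
    simp [Matrix.mul_assoc]
  rw [h2, h]
  simp

theorem single_zero_eq_ketBra : single 0 0 1 = ketBra ketUp := by
  ext i j
  fin_cases i <;> fin_cases j <;> simp [ketBra, ketUp, vecMulVec_apply]

theorem single_one_eq_ketBra : single 1 1 1 = ketBra ketDown := by
  ext i j
  fin_cases i <;> fin_cases j <;> simp [ketBra, ketDown, vecMulVec_apply]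

theorem sum_normSq_eq_one {A : Type} [Fintype A] {φ : Fin 2 × A → ℂ} (hφ : star φ ⬝ᵥ φ = 1) :
    ∑ a, Complex.normSq (φ (0, a)) + ∑ a, Complex.normSq (φ (1, a)) = 1 := by
  have h : star φ ⬝ᵥ φ = ((∑ a, Complex.normSq (φ (0, a)) +
      ∑ a, Complex.normSq (φ (1, a)) : ℝ) : ℂ) := by
    simp [dotProduct, Fintype.sum_prod_type, Fin.sum_univ_two, Complex.normSq_eq_conj_mul_self]
  rw [h] at hφ
  exact_mod_cast hφ

variable {A : Type} [Fintype A] [DecidableEq A]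

theorem integral_expectation_aux (φ : Fin 2 × A → ℂ)
    {C : Matrix ((Fin 2 × A) × Fin 2) ((Fin 2 × A) × Fin 2) ℂ → Matrix (Fin 2) (Fin 2) ℂ}
    (hC : IsLinearMap ℂ C) (U V : Matrix (Fin 2) (Fin 2) ℂ) :
    ∫ ψ, (expectation ψ (Vᴴ * C (ketBra ((U ⊗ₖ (1 : Matrix A A ℂ)) *ᵥ φ) ⊗ₖ ketBra ψ) *
      V)).re ∂pureStateMeasure =
      ∑ r, ∑ r', (gateScore (auxChoi φ C r r') (U * single r r' 1 * Uᴴ) V).re := by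
  simp only [map_ketBra_kronecker φ hC, Matrix.mul_sum, Matrix.sum_mul, expectation_sum,
    Complex.re_sum]
  have hi := fun r r' => integrable_pureStateMeasure
    (continuous_expectation (auxChoi φ C r r') (U * single r r' 1 * Uᴴ) V)
  rw [integral_finsetSum _ fun r _ => integrable_finsetSum _ fun r' _ => hi r r']
  refine Finset.sum_congr rfl fun r _ => ?_
  rw [integral_finsetSum _ fun r' _ => hi r r']
  exact Finset.sum_congr rfl fun r' _ => integral_expectation _ _ _

/-- In the |1⟩ block the probe points along -n, and the rotation by θ about n is the rotation by -θ
about -n. That block is therefore an instance of the first problem at -θ. -/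
theorem fidelity₂_eq (θ : ℝ) (φ : Fin 2 × A → ℂ)
    {C : Matrix ((Fin 2 × A) × Fin 2) ((Fin 2 × A) × Fin 2) ℂ → Matrix (Fin 2) (Fin 2) ℂ}
    (hC : IsLinearMap ℂ C) : fidelity₂ θ φ C =
      (averageScore θ (auxChoi φ C 0 0)).re + (averageScore (-θ) (auxChoi φ C 1 1)).re := by
  have hU := continuous_coe_SU2
  have hV : Continuous (targetGate θ) := by
    change Continuous fun U : SU2 => (U : Matrix (Fin 2) (Fin 2) ℂ) * rotationGateZ θ *
      (U : Matrix (Fin 2) (Fin 2) ℂ)ᴴ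
    exact (hU.matrix_mul continuous_const).matrix_mul hU.matrix_conjTranspose
  have hi : ∀ r r', Integrable (fun U : SU2 => (gateScore (auxChoi φ C r r')
      ((U : Matrix (Fin 2) (Fin 2) ℂ) * single r r' 1 * (U : Matrix (Fin 2) (Fin 2) ℂ)ᴴ)
      (targetGate θ U)).re) haar := fun r r' =>
    (continuous_gateScore _ ((hU.matrix_mul continuous_const).matrix_mul
      hU.matrix_conjTranspose) hV).integrable_of_compactSpace
  have hoff : ∀ r r', r ≠ r' → ∫ U : SU2, (gateScore (auxChoi φ C r r')
      ((U : Matrix (Fin 2) (Fin 2) ℂ) * single r r' 1 * (U : Matrix (Fin 2) (Fin 2) ℂ)ᴴ)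
      -- Translating U on the right by the half turn about z reverses the sign of the integrand.
      (targetGate θ U)).re ∂haar = 0 := fun r r' hr =>
    integral_eq_zero_of_mul_right_eq_neg (g := halfTurnZ) fun U => by
      rw [conj_single_mul_halfTurnZ U hr, gateScore_neg, targetGate_eq, targetGate_eq,
        rotatedAxis_mul_halfTurnZ, Complex.neg_re]
  simp only [fidelity₂, integral_expectation_aux φ hC]
  rw [integral_finsetSum _ fun r _ => integrable_finsetSum _ fun r' _ => hi r r',
    Fin.sum_univ_two, integral_finsetSum _ fun r' _ => hi 0 r',
    integral_finsetSum _ fun r' _ => hi 1 r', Fin.sum_univ_two, Fin.sum_univ_two,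
    hoff 0 1 (by simp), hoff 1 0 (by simp), add_zero, zero_add]
  congr 1
  · simp only [single_zero_eq_ketBra, conj_ketBra_ketUp, targetGate_eq]
    exact hasIsotropicMoments_haar.integral_gateScore θ _
  · simp only [single_one_eq_ketBra, conj_ketBra_ketDown, targetGate_eq,
      ← rotationGate_neg_neg θ]
    exact hasIsotropicMoments_haar.neg.integral_gateScore (-θ) _

theorem fidelity₁_le {θ F : ℝ}
    (h : ∀ t J, IsScaledChoi t J → (averageScore θ J).re ≤ t * F)
    {C : Matrix (Fin 2 × Fin 2) (Fin 2 × Fin 2) ℂ → Matrix (Fin 2) (Fin 2) ℂ}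
    (hC : IsChannel C) : fidelity₁ θ C ≤ F := by
  rw [fidelity₁_eq θ hC.linear]
  simpa using h 1 _ hC.isScaledChoi

/-- The two blocks have trace scalings ‖φ_0‖² and ‖φ_1‖², which add up to 1. -/
theorem fidelity₂_le {θ F : ℝ} (h : ∀ t J, IsScaledChoi t J → (averageScore θ J).re ≤ t * F)
    (h' : ∀ t J, IsScaledChoi t J → (averageScore (-θ) J).re ≤ t * F)
    {φ : Fin 2 × A → ℂ} (hφ : star φ ⬝ᵥ φ = 1)
    {C : Matrix ((Fin 2 × A) × Fin 2) ((Fin 2 × A) × Fin 2) ℂ → Matrix (Fin 2) (Fin 2) ℂ}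
    (hC : IsChannel C) : fidelity₂ θ φ C ≤ F := by
  rw [fidelity₂_eq θ φ hC.linear]
  have h0 := h _ _ (hC.isScaledChoi_auxChoi φ 0)
  have h1 := h' _ _ (hC.isScaledChoi_auxChoi φ 1)
  calc _ ≤ _ := add_le_add h0 h1
    _ = F := by rw [← add_mul, sum_normSq_eq_one hφ, one_mul]

theorem IsChannel.trivialAuxMap
    {C : Matrix (Fin 2 × Fin 2) (Fin 2 × Fin 2) ℂ → Matrix (Fin 2) (Fin 2) ℂ}
    (hC : IsChannel C) : IsChannel (trivialAuxMap C) where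
  linear := ⟨fun X Y => hC.linear.map_add _ _, fun c X => hC.linear.map_smul _ _⟩
  completelyPositive k X hX := hC.completelyPositive k
    (X.submatrix (fun p => (((p.1.1, ()), p.1.2), p.2)) fun p => (((p.1.1, ()), p.1.2), p.2))
    (hX.submatrix _)
  tracePreserving X := by
    simp only [RotationLearning.trivialAuxMap, hC.tracePreserving]
    simp [Matrix.trace, Fintype.sum_prod_type]

/-- The probe state |0⟩ has no |1⟩ block, and its |0⟩ block is the Choi matrix of the channel
itself. -/
theorem fidelity₂_trivialAux (θ : ℝ)
    {C : Matrix (Fin 2 × Fin 2) (Fin 2 × Fin 2) ℂ → Matrix (Fin 2) (Fin 2) ℂ}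
    (hC : IsChannel C) :
    fidelity₂ θ (trivialAuxState ketUp) (trivialAuxMap C) = fidelity₁ θ C := by
  have h0 : auxChoi (trivialAuxState ketUp) (trivialAuxMap C) 0 0 = choi C := by
    ext i j
    simp only [auxChoi, choi, of_apply, trivialAuxMap]
    congr 1
    ext p q
    simp [vecMulVec_apply, trivialAuxState, ketUp]
    left
    rw [Pi.single_apply]
    split_ifs <;> simp
  have h1 : auxChoi (trivialAuxState ketUp) (trivialAuxMap C) 1 1 = 0 := by
    ext i j
    have e : (vecMulVec (fun q : (Fin 2 × Unit) × Fin 2 =>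
        (Pi.single i.1 1 : Fin 2 × Fin 2 → ℂ) (q.1.1, q.2) * trivialAuxState ketUp (1, q.1.2))
        (star fun q : (Fin 2 × Unit) × Fin 2 => (Pi.single j.1 1 : Fin 2 × Fin 2 → ℂ)
          (q.1.1, q.2) * trivialAuxState ketUp (1, q.1.2))) = 0 := by
      ext p q
      simp [vecMulVec_apply, trivialAuxState, ketUp]
    simp only [auxChoi, of_apply, e, hC.trivialAuxMap.linear.map_zero, Matrix.zero_apply]
  rw [fidelity₂_eq θ _ hC.trivialAuxMap.linear, fidelity₁_eq θ hC.linear, h0, h1]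
  simp [averageScore]

/-- A channel that attains a common bound is optimal for both problems. -/
theorem optimal_of_fidelity₁_eq {θ F : ℝ}
    (h : ∀ t J, IsScaledChoi t J → (averageScore θ J).re ≤ t * F)
    (h' : ∀ t J, IsScaledChoi t J → (averageScore (-θ) J).re ≤ t * F)
    {C : Matrix (Fin 2 × Fin 2) (Fin 2 × Fin 2) ℂ → Matrix (Fin 2) (Fin 2) ℂ}
    (hC : IsChannel C) (hF : fidelity₁ θ C = F) :
    (IsOptimal₁ θ C ∧ fidelity₁ θ C = F) ∧
      (IsOptimal₂ θ (trivialAuxState ketUp) (trivialAuxMap C) ∧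
        fidelity₂ θ (trivialAuxState ketUp) (trivialAuxMap C) = F) := by
  have h2 := fidelity₂_trivialAux θ hC
  rw [hF] at h2
  refine ⟨⟨⟨hC, fun C' hC' => hF ▸ fidelity₁_le h hC'⟩, hF⟩,
    ⟨⟨⟨?_, hC.trivialAuxMap⟩, fun B _ _ φ' C' hφ' hC' => h2 ▸ fidelity₂_le h h' hφ' hC'⟩, h2⟩⟩
  simp [dotProduct, Fintype.sum_prod_type, Fin.sum_univ_two, trivialAuxState, ketUp]

/-! ### Channels in Kraus form -/

/-- The completely positive map with Kraus operators `K`. -/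
def krausMap {κ : Type*} [Fintype κ] (K : κ → Matrix (Fin 2) (Fin 2 × Fin 2) ℂ)
    (ρ : Matrix (Fin 2 × Fin 2) (Fin 2 × Fin 2) ℂ) : Matrix (Fin 2) (Fin 2) ℂ :=
  ∑ k, K k * ρ * (K k)ᴴ

section Kraus

variable {κ : Type*} [Fintype κ]

theorem isChannel_krausMap (K : κ → Matrix (Fin 2) (Fin 2 × Fin 2) ℂ)
    (hK : ∑ k, (K k)ᴴ * K k = 1) : IsChannel (krausMap K) where
  linear := ⟨fun X Y => by simp [krausMap, Matrix.mul_add, Matrix.add_mul, Finset.sum_add_distrib],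
    fun c X => by simp [krausMap, Finset.smul_sum]⟩
  completelyPositive n X hX := by
    have e : ampliation (krausMap K) n X = ∑ k, (K k ⊗ₖ (1 : Matrix (Fin n) (Fin n) ℂ)) * X *
        (K k ⊗ₖ (1 : Matrix (Fin n) (Fin n) ℂ))ᴴ := by
      ext ⟨a, i⟩ ⟨b, j⟩
      simp [ampliation, krausMap, Matrix.sum_apply, Matrix.mul_apply, kroneckerMap_apply,
        Fintype.sum_prod_type (α₁ := Fin 2 × Fin 2) (α₂ := Fin n), one_apply, apply_ite]
    rw [e]
    exact posSemidef_sum _ fun k _ => hX.mul_mul_conjTranspose_same _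
  tracePreserving X := by
    simp only [krausMap, Matrix.trace_sum]
    rw [Finset.sum_congr rfl fun k _ => Matrix.trace_mul_cycle (K k) X (K k)ᴴ,
      ← Matrix.trace_sum, ← Matrix.sum_mul, hK, Matrix.one_mul]

theorem choi_krausMap (K : κ → Matrix (Fin 2) (Fin 2 × Fin 2) ℂ)
    (i j : (Fin 2 × Fin 2) × Fin 2) :
    choi (krausMap K) i j = ∑ k, K k i.2 i.1 * star (K k j.2 j.1) := by
  simp only [choi, krausMap, of_apply, Matrix.sum_apply]
  refine Finset.sum_congr rfl fun k _ => ?_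
  rw [mul_vecMulVec, vecMulVec_mul, vecMulVec_apply]
  simp [vecMul, dotProduct, Pi.single_apply, apply_ite]

theorem overlapA_krausMap (K : κ → Matrix (Fin 2) (Fin 2 × Fin 2) ℂ) :
    overlapA (choi (krausMap K)) = ∑ k, ∑ p, (∑ a, K k a (p, a)) * star (∑ a, K k a (p, a)) := by
  simp only [overlapA, choi_krausMap, star_sum, Finset.sum_mul_sum]
  rw [Finset.sum_comm]
  simp only [Fin.sum_univ_two, ← Finset.sum_add_distrib]
  exact Finset.sum_congr rfl fun k _ => by ring

theorem overlapD_krausMap (K : κ → Matrix (Fin 2) (Fin 2 × Fin 2) ℂ) :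
    overlapD (choi (krausMap K)) = ∑ k, ∑ s, (∑ p, K k p (p, s)) * star (∑ a, K k a (s, a)) := by
  simp only [overlapD, choi_krausMap, star_sum, Finset.sum_mul_sum]
  simp only [Fin.sum_univ_two, ← Finset.sum_add_distrib]
  exact Finset.sum_congr rfl fun k _ => by ring

end Kraus

/-! ### The Heisenberg gate -/

theorem proj₁_apply (i j : Fin 2 × Fin 2) : proj₁ i j =
    1 / 2 * ((if i = j then 1 else 0) + if i.1 = j.2 ∧ i.2 = j.1 then 1 else 0) := by
  obtain ⟨a, b⟩ := i
  obtain ⟨c, d⟩ := j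
  fin_cases a <;> fin_cases b <;> fin_cases c <;> fin_cases d <;>
    simp [proj₁, totalSpinSq, spinOp, pauli, pow_two, Matrix.mul_apply, Fin.sum_univ_succ,
      Fintype.sum_prod_type, Matrix.one_apply, Matrix.add_apply] <;> ring_nf <;>
    simp [Complex.I_sq] <;> norm_num

theorem heisenbergCoupling_eq :
    heisenbergCoupling = (1 / 2 : ℂ) • proj₁ + (-(3 / 2) : ℂ) • proj₀ := by
  ext ⟨a, b⟩ ⟨c, d⟩
  simp only [proj₀, Matrix.add_apply, Matrix.smul_apply, Matrix.sub_apply, proj₁_apply,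
    heisenbergCoupling]
  fin_cases a <;> fin_cases b <;> fin_cases c <;> fin_cases d <;>
    simp [spinOp, pauli, Fin.sum_univ_succ] <;> ring_nf <;>
    simp [Complex.I_sq] <;> norm_num

theorem proj₁_mul_proj₁ : proj₁ * proj₁ = proj₁ := proj_spec.2.1

theorem proj₁_conjTranspose : proj₁ᴴ = proj₁ := proj_spec.1

theorem proj₁_mul_proj₀ : proj₁ * proj₀ = 0 := by
  rw [proj₀, Matrix.mul_sub, proj₁_mul_proj₁, Matrix.mul_one, sub_self]

theorem proj₀_mul_proj₁ : proj₀ * proj₁ = 0 := by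
  rw [proj₀, Matrix.sub_mul, proj₁_mul_proj₁, Matrix.one_mul, sub_self]

theorem proj₀_mul_proj₀ : proj₀ * proj₀ = proj₀ := by
  conv_lhs => rw [proj₀, Matrix.sub_mul, Matrix.one_mul, ← proj₀, proj₁_mul_proj₀, sub_zero]

theorem proj₀_conjTranspose : proj₀ᴴ = proj₀ := by
  rw [proj₀, conjTranspose_sub, proj₁_conjTranspose, conjTranspose_one]

theorem proj₁_add_proj₀ : proj₁ + proj₀ = 1 := add_sub_cancel _ _

/-- The algebra of the matrices `a P₁ + b P₀`. -/
def blockHom : ℂ × ℂ →+* Matrix (Fin 2 × Fin 2) (Fin 2 × Fin 2) ℂ where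
  toFun z := z.1 • proj₁ + z.2 • proj₀
  map_one' := by simp [proj₁_add_proj₀]
  map_zero' := by simp
  map_add' x y := by simp only [Prod.fst_add, Prod.snd_add, add_smul]; abel
  map_mul' x y := by
    simp [Matrix.add_mul, Matrix.mul_add, proj₁_mul_proj₁, proj₁_mul_proj₀, proj₀_mul_proj₁,
      proj₀_mul_proj₀, smul_smul, mul_comm]

theorem blockHom_apply (a b : ℂ) : blockHom (a, b) = a • proj₁ + b • proj₀ := rfl

theorem continuous_blockHom : Continuous blockHom :=
  (continuous_fst.smul continuous_const).add (continuous_snd.smul continuous_const)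

theorem blockHom_conjTranspose (a b : ℂ) :
    (blockHom (a, b))ᴴ = blockHom (star a, star b) := by
  simp [blockHom_apply, proj₁_conjTranspose, proj₀_conjTranspose]

/-- A continuous ring homomorphism compatible with scalars can be applied termwise to the
exponential series, and on ℂ × ℂ the exponential is componentwise. -/
theorem exp_blockHom (a b : ℂ) :
    NormedSpace.exp (blockHom (a, b)) = blockHom (Complex.exp a, Complex.exp b) := by
  have hexp : NormedSpace.exp ((a, b) : ℂ × ℂ) = (Complex.exp a, Complex.exp b) := by
    ext
    · rw [Prod.fst_exp, Complex.exp_eq_exp_ℂ]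
    · rw [Prod.snd_exp, Complex.exp_eq_exp_ℂ]
  have h := ((NormedSpace.exp_series_hasSum_exp' (𝕂 := ℂ) ((a, b) : ℂ × ℂ)).map blockHom
    continuous_blockHom).tsum_eq
  rw [hexp] at h
  rw [← h, NormedSpace.exp_eq_tsum ℂ]
  refine tsum_congr fun n => ?_
  rw [← map_pow, Function.comp_apply]
  simp [blockHom_apply, smul_smul]

/-- The coupling has eigenvalues 1/2 and -3/2, so the gate is a global phase times P₁ + e^{if} P₀;
only the relative phase f matters. -/
theorem heisenbergGate_eq (θ : ℝ) : heisenbergGate θ =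
    blockHom (Complex.exp (-(Complex.I * heisenbergAngle θ / 4)),
      Complex.exp (-(Complex.I * heisenbergAngle θ / 4)) *
        Complex.exp (heisenbergAngle θ * Complex.I)) := by
  rw [← Complex.exp_add, ← exp_blockHom, heisenbergGate, heisenbergCoupling_eq]
  congr 1
  rw [blockHom_apply, smul_add, smul_smul, smul_smul]
  congr 2 <;> ring

/-! ### The angle of the Heisenberg gate -/

theorem sqrt_one_add_cot_sq {θ : ℝ} (h : Real.sin θ ≠ 0) :
    √(1 + (Real.cot θ + 1 / (2 * Real.sin θ)) ^ 2) =
      √(5 + 4 * Real.cos θ) / (2 * |Real.sin θ|) := by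
  rw [← Real.sqrt_sq (by positivity : 0 ≤ 2 * |Real.sin θ|), ← Real.sqrt_div
    (by linarith [Real.neg_one_le_cos θ])]
  congr 1
  rw [mul_pow, sq_abs, Real.cot_eq_cos_div_sin]
  field_simp
  linear_combination 4 * Real.sin_sq_add_cos_sq θ

/-- The angle is an argument of z = 1 + 2cos θ + 2i sin θ, of modulus √(5 + 4cos θ). The cotangent
determines it up to π, and the values at 0 and π agree with this description. -/
theorem cos_sin_heisenbergAngle {θ : ℝ} (hθ : θ ∈ Set.Ico 0 (2 * Real.pi)) :
    Real.cos (heisenbergAngle θ) = (1 + 2 * Real.cos θ) / √(5 + 4 * Real.cos θ) ∧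
      Real.sin (heisenbergAngle θ) = 2 * Real.sin θ / √(5 + 4 * Real.cos θ) := by
  have hR : 0 < √(5 + 4 * Real.cos θ) :=
    Real.sqrt_pos.mpr (by linarith [Real.neg_one_le_cos θ])
  by_cases hs : Real.sin θ = 0
  · rw [heisenbergAngle, if_pos hs, hs]
    refine ⟨?_, by simp⟩
    rcases lt_trichotomy θ Real.pi with hlt | rfl | hgt
    · have h0 : θ = 0 := by
        by_contra hne
        exact (Real.sin_pos_of_pos_of_lt_pi (lt_of_le_of_ne hθ.1 (Ne.symm hne)) hlt).ne' hs
      subst h0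
      rw [Real.cos_zero, show (5 : ℝ) + 4 * 1 = 3 ^ 2 by norm_num,
        Real.sqrt_sq (by norm_num : (0 : ℝ) ≤ 3)]
      norm_num
    · rw [Real.cos_pi]
      norm_num
    · have := Real.sin_neg_of_neg_of_neg_pi_lt (x := θ - 2 * Real.pi) (by linarith [hθ.2])
        (by linarith)
      rw [Real.sin_sub_two_pi] at this
      exact absurd hs this.ne
  · have hsq := sqrt_one_add_cot_sq hs
    have hpos : 0 < |Real.sin θ| := abs_pos.mpr hs
    have hx : Real.cot θ + 1 / (2 * Real.sin θ) = (1 + 2 * Real.cos θ) / (2 * Real.sin θ) := by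
      rw [Real.cot_eq_cos_div_sin]
      field_simp
      ring
    rw [heisenbergAngle, if_neg hs]
    split_ifs with hp
    · have hs0 : 0 < Real.sin θ :=
        lt_of_le_of_ne (Real.sin_nonneg_of_nonneg_of_le_pi hθ.1 hp) (Ne.symm hs)
      rw [add_zero, arccot, Real.cos_pi_div_two_sub, Real.sin_pi_div_two_sub, Real.sin_arctan,
        Real.cos_arctan, hsq, abs_of_pos hs0, hx]
      constructor <;> field_simp
    · have hs0 : Real.sin θ < 0 := by
        have := Real.sin_neg_of_neg_of_neg_pi_lt (x := θ - 2 * Real.pi) (by linarith [hθ.2])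
          (by linarith)
        rwa [Real.sin_sub_two_pi] at this
      -- The shift by π changes both signs, which compensates |sin θ| = -sin θ on this half of the
      -- circle.
      rw [arccot, Real.cos_add_pi, Real.sin_add_pi, Real.cos_pi_div_two_sub,
        Real.sin_pi_div_two_sub, Real.sin_arctan, Real.cos_arctan, hsq, abs_of_neg hs0, hx]
      constructor <;> field_simp

/-! ### The universal NOT -/

/-- The Kraus operators of the universal NOT. -/
def unotKraus : Fin 4 → Matrix (Fin 2) (Fin 2 × Fin 2) ℂ :=
  ![of fun a j => if a = 1 ∧ j = (0, 0) then (√3 : ℂ) / 2 else 0,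
    of fun a j => if a = 1 ∧ (j = (0, 1) ∨ j = (1, 0)) then 1 / 2 else
      if a = 0 ∧ j = (0, 0) then -(1 / 2) else 0,
    of fun a j => if a = 0 ∧ (j = (0, 1) ∨ j = (1, 0)) then 1 / 2 else
      if a = 1 ∧ j = (1, 1) then -(1 / 2) else 0,
    of fun a j => if a = 0 ∧ j = (1, 1) then (√3 : ℂ) / 2 else 0]

theorem ofReal_sqrt_three_sq : (√3 : ℂ) ^ 2 = 3 := by
  exact_mod_cast Real.sq_sqrt (by norm_num : (0 : ℝ) ≤ 3)

theorem expectation_conj_kronecker (U : Matrix (Fin 2) (Fin 2) ℂ) (φ : Fin 2 → ℂ)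
    (ρ : Matrix (Fin 2 × Fin 2) (Fin 2 × Fin 2) ℂ) :
    expectation (fun p : Fin 2 × Fin 2 => φ p.1 * φ p.2) ((U ⊗ₖ U)ᴴ * ρ * (U ⊗ₖ U)) =
      ∑ i, ∑ j, ρ i j * ((U * ketBra φ * Uᴴ) j.1 i.1 * (U * ketBra φ * Uᴴ) j.2 i.2) := by
  have hU : (U ⊗ₖ U) *ᵥ (fun p : Fin 2 × Fin 2 => φ p.1 * φ p.2) =
      fun p => (U *ᵥ φ) p.1 * (U *ᵥ φ) p.2 := by
    ext p
    simp only [mulVec, dotProduct, kroneckerMap_apply, Fintype.sum_prod_type, Finset.sum_mul_sum]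
    exact Finset.sum_congr rfl fun i _ => Finset.sum_congr rfl fun j _ => by ring
  have h1 : expectation (fun p : Fin 2 × Fin 2 => φ p.1 * φ p.2) ((U ⊗ₖ U)ᴴ * ρ * (U ⊗ₖ U)) =
      expectation (fun p => (U *ᵥ φ) p.1 * (U *ᵥ φ) p.2) ρ := by
    rw [expectation, expectation, ← hU, star_mulVec, ← dotProduct_mulVec, mulVec_mulVec,
      mulVec_mulVec, Matrix.mul_assoc]
  rw [h1, expectation_eq_sum, ← ketBra_mulVec]
  refine Finset.sum_congr rfl fun i _ => Finset.sum_congr rfl fun j _ => ?_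
  simp only [ketBra, vecMulVec_apply, Pi.star_apply, star_mul']
  ring

theorem integral_universalNot (a b c d e f : Fin 2) :
    ∫ U, coherentState (rotatedAxis U) a b * coherentState (rotatedAxis U) c d *
      coherentState (-rotatedAxis U) e f ∂haar =
    1 / 8 * ((1 : Matrix (Fin 2) (Fin 2) ℂ) a b * (1 : Matrix (Fin 2) (Fin 2) ℂ) c d *
        (1 : Matrix (Fin 2) (Fin 2) ℂ) e f +
      pauliMoment a b c d * (1 : Matrix (Fin 2) (Fin 2) ℂ) e f -
      pauliMoment a b e f * (1 : Matrix (Fin 2) (Fin 2) ℂ) c d -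
      pauliMoment c d e f * (1 : Matrix (Fin 2) (Fin 2) ℂ) a b) := by
  have h := hasIsotropicMoments_haar.integral_affine_mul_mul
    (1 / 2 * (1 : Matrix (Fin 2) (Fin 2) ℂ) a b) (1 / 2)
    (1 / 2 * (1 : Matrix (Fin 2) (Fin 2) ℂ) c d) (1 / 2)
    (1 / 2 * (1 : Matrix (Fin 2) (Fin 2) ℂ) e f) (-(1 / 2)) a b c d e f
  have hneg : ∀ U, coherentState (-rotatedAxis U) e f =
      1 / 2 * (1 : Matrix (Fin 2) (Fin 2) ℂ) e f +
        -(1 / 2) * dotPauli (rotatedAxis U) e f := fun U => by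
    have : dotPauli (-rotatedAxis U) = -dotPauli (rotatedAxis U) := by simp [dotPauli]
    rw [coherentState_apply, this, Matrix.neg_apply]
    ring
  simp only [hneg, coherentState_apply]
  rw [h]
  ring

/-- The integrand is again a product of three affine functions of the axis, so both sides can be
compared entry by entry. -/
theorem universalNot_eq_krausMap (ρ : Matrix (Fin 2 × Fin 2) (Fin 2 × Fin 2) ℂ) :
    universalNot ρ = krausMap unotKraus ρ := by
  have hint : ∀ a b, universalNot ρ a b = ∑ i, ∑ j, 3 * ρ i j * ∫ U,
      coherentState (rotatedAxis U) j.1 i.1 * coherentState (rotatedAxis U) j.2 i.2 *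
        coherentState (-rotatedAxis U) a b ∂haar := fun a b => by
    have hc := continuous_coherentState_rotatedAxis
    have hc' : Continuous fun U => coherentState (-rotatedAxis U) a b := by
      simp only [coherentState_apply]
      exact continuous_const.add (continuous_const.mul
        (hasIsotropicMoments_haar.neg.continuous_dotPauli a b))
    have hi : ∀ i j : Fin 2 × Fin 2, Integrable (fun U => 3 * ρ i j *
        (coherentState (rotatedAxis U) j.1 i.1 * coherentState (rotatedAxis U) j.2 i.2 *
          coherentState (-rotatedAxis U) a b)) haar := fun i j =>
      (continuous_const.mul (((hc _ _).mul (hc _ _)).mul hc')).integrable_of_compactSpace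
    simp only [universalNot, of_apply, expectation_conj_kronecker, conj_ketBra_ketUp,
      conj_ketBra_ketDown, Finset.mul_sum, Finset.sum_mul]
    rw [← integral_congr_ae (f := fun U => ∑ i, ∑ j, 3 * ρ i j *
        (coherentState (rotatedAxis U) j.1 i.1 * coherentState (rotatedAxis U) j.2 i.2 *
          coherentState (-rotatedAxis U) a b))]
    · rw [integral_finsetSum _ fun i _ => integrable_finsetSum _ fun j _ => hi i j]
      refine Finset.sum_congr rfl fun i _ => ?_
      rw [integral_finsetSum _ fun j _ => hi i j]
      simp only [integral_const_mul]
    · exact Filter.Eventually.of_forall fun U => Finset.sum_congr rfl fun i _ =>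
        Finset.sum_congr rfl fun j _ => by ring
  ext a b
  rw [hint]
  simp only [integral_universalNot, pauliMoment, krausMap, Matrix.sum_apply, Matrix.mul_apply,
    conjTranspose_apply, Fintype.sum_prod_type, Fin.sum_univ_two, Fin.sum_univ_four]
  clear hint
  revert a b
  simp only [Fin.forall_fin_two]
  refine ⟨⟨?_, ?_⟩, ?_, ?_⟩ <;> simp [unotKraus, one_apply] <;> ring_nf <;>
    (try simp only [ofReal_sqrt_three_sq]) <;> ring

theorem sum_unotKraus_conjTranspose_mul : ∑ m, (unotKraus m)ᴴ * unotKraus m = proj₁ := by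
  ext ⟨a, b⟩ ⟨c, d⟩
  rw [proj₁_apply]
  simp only [Matrix.sum_apply, Matrix.mul_apply, conjTranspose_apply, Fin.sum_univ_two,
    Fin.sum_univ_four]
  fin_cases a <;> fin_cases b <;> fin_cases c <;> fin_cases d <;> simp [unotKraus] <;>
    ring_nf <;> simp only [ofReal_sqrt_three_sq] <;> norm_num

theorem unotKraus_mul_proj₁ (m : Fin 4) : unotKraus m * proj₁ = unotKraus m := by
  ext a ⟨c, d⟩
  simp only [Matrix.mul_apply, Fintype.sum_prod_type, Fin.sum_univ_two, proj₁_apply]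
  fin_cases m <;> fin_cases a <;> fin_cases c <;> fin_cases d <;> simp [unotKraus] <;> ring

/-- Orthogonality to the vectors a_p: the universal NOT lies entirely in the spin-3/2 component, so
it contributes neither to A nor to D and only restores the trace. -/
theorem sum_unotKraus (m : Fin 4) (p : Fin 2) : ∑ a, unotKraus m a (p, a) = 0 := by
  fin_cases m <;> fin_cases p <;> simp [unotKraus, Fin.sum_univ_two]

/-! ### The fidelity of the optimal strategies -/

/-- The Kraus operators `⟨q|G` of the map `ρ ↦ Tr_P [G ρ G†]`. -/
def probeKraus (G : Matrix (Fin 2 × Fin 2) (Fin 2 × Fin 2) ℂ) (q : Fin 2) :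
    Matrix (Fin 2) (Fin 2 × Fin 2) ℂ :=
  of fun a j => G (q, a) j

theorem traceProbe_eq_krausMap (G ρ : Matrix (Fin 2 × Fin 2) (Fin 2 × Fin 2) ℂ) :
    traceProbe (G * ρ * Gᴴ) = krausMap (probeKraus G) ρ := by
  ext a b
  simp [traceProbe, krausMap, probeKraus, Matrix.mul_apply, Matrix.sum_apply]

theorem sum_probeKraus_conjTranspose_mul (G : Matrix (Fin 2 × Fin 2) (Fin 2 × Fin 2) ℂ) :
    ∑ q, (probeKraus G q)ᴴ * probeKraus G q = Gᴴ * G := by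
  ext i j
  simp [probeKraus, Matrix.mul_apply, Matrix.sum_apply, Fintype.sum_prod_type]

theorem blockHom_entry (w : ℂ × ℂ) (i j : Fin 2 × Fin 2) : blockHom w i j =
    (w.1 + w.2) / 2 * (if i = j then 1 else 0) +
      (w.1 - w.2) / 2 * if i.1 = j.2 ∧ i.2 = j.1 then 1 else 0 := by
  rw [← Prod.mk.eta (p := w), blockHom_apply]
  simp only [proj₀, Matrix.add_apply, Matrix.smul_apply, Matrix.sub_apply, proj₁_apply,
    smul_eq_mul, one_apply]
  ring

theorem sum_probeKraus_target (w : ℂ × ℂ) (q p : Fin 2) :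
    ∑ a, probeKraus (blockHom w) q a (p, a) =
      (3 * w.1 + w.2) / 2 * (1 : Matrix (Fin 2) (Fin 2) ℂ) q p := by
  simp only [probeKraus, of_apply, blockHom_entry, Fin.sum_univ_two]
  fin_cases q <;> fin_cases p <;> simp <;> ring

theorem sum_probeKraus_probe (w : ℂ × ℂ) (q s : Fin 2) :
    ∑ p, probeKraus (blockHom w) q p (p, s) =
      (3 * w.1 - w.2) / 2 * (1 : Matrix (Fin 2) (Fin 2) ℂ) q s := by
  simp only [probeKraus, of_apply, blockHom_entry, Fin.sum_univ_two]
  fin_cases q <;> fin_cases s <;> simp <;> ring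

/-- The Kraus operators of the map that applies `w₁ P₁ + w₀ P₀` and discards the probe, plus `s²`
times the universal NOT. -/
def mixedKraus (w : ℂ × ℂ) (s : ℝ) : Fin 2 ⊕ Fin 4 → Matrix (Fin 2) (Fin 2 × Fin 2) ℂ :=
  Sum.elim (probeKraus (blockHom w)) fun m => (s : ℂ) • unotKraus m

theorem blockHom_conjTranspose_mul (w : ℂ × ℂ) :
    (blockHom w)ᴴ * blockHom w = blockHom (star w.1 * w.1, star w.2 * w.2) := by
  rw [← Prod.mk.eta (p := w), blockHom_conjTranspose, ← map_mul]
  rfl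

theorem isChannel_mixedKraus {w : ℂ × ℂ} {s : ℝ} (h1 : star w.1 * w.1 + s ^ 2 = 1)
    (h0 : star w.2 * w.2 = 1) : IsChannel (krausMap (mixedKraus w s)) := by
  refine isChannel_krausMap _ ?_
  have hs : ∀ m, ((s : ℂ) • unotKraus m)ᴴ * ((s : ℂ) • unotKraus m) =
      ((s : ℂ) ^ 2) • ((unotKraus m)ᴴ * unotKraus m) := fun m => by
    rw [conjTranspose_smul, Matrix.smul_mul, Matrix.mul_smul, smul_smul, Complex.star_def,
      Complex.conj_ofReal, ← pow_two]
  simp only [mixedKraus, Fintype.sum_sum_type, Sum.elim_inl, Sum.elim_inr, hs, ← Finset.smul_sum,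
    sum_unotKraus_conjTranspose_mul, sum_probeKraus_conjTranspose_mul, blockHom_conjTranspose_mul,
    blockHom_apply, h0]
  rw [add_right_comm, ← add_smul, h1, one_smul, one_smul, proj₁_add_proj₀]

theorem overlapA_mixedKraus (w : ℂ × ℂ) (s : ℝ) :
    overlapA (choi (krausMap (mixedKraus w s))) =
      (3 * w.1 + w.2) * star (3 * w.1 + w.2) / 2 := by
  simp only [overlapA_krausMap, mixedKraus, Fintype.sum_sum_type, Sum.elim_inl, Sum.elim_inr,
    Matrix.smul_apply, ← Finset.smul_sum, sum_unotKraus, sum_probeKraus_target]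
  simp [Fin.sum_univ_two]
  ring

theorem overlapD_mixedKraus (w : ℂ × ℂ) (s : ℝ) :
    overlapD (choi (krausMap (mixedKraus w s))) =
      (3 * w.1 - w.2) * star (3 * w.1 + w.2) / 2 := by
  simp only [overlapD_krausMap, mixedKraus, Fintype.sum_sum_type, Sum.elim_inl, Sum.elim_inr,
    Matrix.smul_apply, ← Finset.smul_sum, sum_unotKraus, sum_probeKraus_target,
    sum_probeKraus_probe]
  simp [Fin.sum_univ_two]
  ring

/-- The pair of eigenvalues of the Heisenberg gate, multiplied by `r` on the subspace with total
angular momentum one. -/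
def heisenbergPair (θ r : ℝ) : ℂ × ℂ :=
  (Complex.exp (-(Complex.I * heisenbergAngle θ / 4)) * r,
    Complex.exp (-(Complex.I * heisenbergAngle θ / 4)) *
      Complex.exp (heisenbergAngle θ * Complex.I))

theorem star_mul_exp_phase (θ : ℝ) : star (Complex.exp (-(Complex.I * heisenbergAngle θ / 4))) *
    Complex.exp (-(Complex.I * heisenbergAngle θ / 4)) = 1 := by
  rw [Complex.star_def, ← Complex.exp_conj, ← Complex.exp_add, ← Complex.exp_zero]
  congr 1
  simp [map_ofNat]
  ring

theorem star_mul_exp_angle (f : ℝ) :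
    star (Complex.exp (f * Complex.I)) * Complex.exp (f * Complex.I) = 1 := by
  rw [Complex.star_def, ← Complex.exp_conj, ← Complex.exp_add, ← Complex.exp_zero]
  congr 1
  simp

theorem isChannel_heisenbergPair (θ : ℝ) {r s : ℝ} (h : r ^ 2 + s ^ 2 = 1) :
    IsChannel (krausMap (mixedKraus (heisenbergPair θ r) s)) := by
  have h1 := star_mul_exp_phase θ
  have h2 := star_mul_exp_angle (heisenbergAngle θ)
  have h' : (r : ℂ) ^ 2 + (s : ℂ) ^ 2 = 1 := by exact_mod_cast h
  refine isChannel_mixedKraus ?_ ?_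
  · simp only [heisenbergPair, star_mul', Complex.star_def, Complex.conj_ofReal] at h1 ⊢
    linear_combination (r : ℂ) ^ 2 * h1 + h'
  · simp only [heisenbergPair, star_mul'] at h1 ⊢
    linear_combination (star (Complex.exp (heisenbergAngle θ * Complex.I)) *
      Complex.exp (heisenbergAngle θ * Complex.I)) * h1 + h2

/-- The phase f enters through (1 + 2cos θ) cos f + 2 sin θ sin f, which equals |z| because f is the
argument of z. What remains is a quadratic in r, maximised at r = 1 or at the value given by
`alpha`. -/
theorem fidelity₁_heisenbergPair {θ : ℝ} (hθ : θ ∈ Set.Ico 0 (2 * Real.pi)) {r s : ℝ}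
    (h : r ^ 2 + s ^ 2 = 1) :
    fidelity₁ θ (krausMap (mixedKraus (heisenbergPair θ r) s)) =
      1 / 3 + 1 / 36 * ((1 + 2 * Real.cos θ) * (9 * r ^ 2 + 1) / 2 + 4 * (1 - Real.cos θ) +
        3 * r * √(5 + 4 * Real.cos θ)) := by
  have hC := isChannel_heisenbergPair θ h
  have h1 := star_mul_exp_phase θ
  obtain ⟨hcos, hsin⟩ := cos_sin_heisenbergAngle hθ
  have hR : 0 < √(5 + 4 * Real.cos θ) :=
    Real.sqrt_pos.mpr (by linarith [Real.neg_one_le_cos θ])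
  have hR2 := Real.sq_sqrt (by linarith [Real.neg_one_le_cos θ] : 0 ≤ 5 + 4 * Real.cos θ)
  have he : Complex.exp (heisenbergAngle θ * Complex.I) =
      ⟨Real.cos (heisenbergAngle θ), Real.sin (heisenbergAngle θ)⟩ := by
    rw [Complex.exp_mul_I, ← Complex.ofReal_cos, ← Complex.ofReal_sin]
    apply Complex.ext <;> simp [-Complex.ofReal_cos, -Complex.ofReal_sin]
  have hA : (3 * (heisenbergPair θ r).1 + (heisenbergPair θ r).2) *
      star (3 * (heisenbergPair θ r).1 + (heisenbergPair θ r).2) / 2 =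
      (3 * r + Complex.exp (heisenbergAngle θ * Complex.I)) *
        star (3 * r + Complex.exp (heisenbergAngle θ * Complex.I)) / 2 := by
    simp only [heisenbergPair, star_add, star_mul', star_ofNat, Complex.star_def,
      Complex.conj_ofReal] at h1 ⊢
    linear_combination (3 * r + Complex.exp (heisenbergAngle θ * Complex.I)) *
      (3 * r + (starRingEnd ℂ) (Complex.exp (heisenbergAngle θ * Complex.I))) / 2 * h1
  have hD : (3 * (heisenbergPair θ r).1 - (heisenbergPair θ r).2) *
      star (3 * (heisenbergPair θ r).1 + (heisenbergPair θ r).2) / 2 =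
      (3 * r - Complex.exp (heisenbergAngle θ * Complex.I)) *
        star (3 * r + Complex.exp (heisenbergAngle θ * Complex.I)) / 2 := by
    simp only [heisenbergPair, star_add, star_mul', star_ofNat, Complex.star_def,
      Complex.conj_ofReal] at h1 ⊢
    linear_combination (3 * r - Complex.exp (heisenbergAngle θ * Complex.I)) *
      (3 * r + (starRingEnd ℂ) (Complex.exp (heisenbergAngle θ * Complex.I))) / 2 * h1
  have hAre : (overlapA (choi (krausMap (mixedKraus (heisenbergPair θ r) s)))).re =
      (9 * r ^ 2 + 1 + 6 * r * Real.cos (heisenbergAngle θ)) / 2 := by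
    rw [overlapA_mixedKraus, hA, he]
    simp
    linear_combination Real.sin_sq_add_cos_sq (heisenbergAngle θ)
  have hDim : (overlapD (choi (krausMap (mixedKraus (heisenbergPair θ r) s)))).im =
      -3 * r * Real.sin (heisenbergAngle θ) := by
    rw [overlapD_mixedKraus, hD, he]
    simp
    ring
  rw [fidelity₁_eq θ hC.linear, hC.isScaledChoi.re_averageScore, hAre, hDim, hcos, hsin]
  have hcs := Real.sin_sq_add_cos_sq θ
  have key : (1 + 2 * Real.cos θ) * ((1 + 2 * Real.cos θ) / √(5 + 4 * Real.cos θ)) +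
      2 * Real.sin θ * (2 * Real.sin θ / √(5 + 4 * Real.cos θ)) = √(5 + 4 * Real.cos θ) := by
    rw [← mul_div_assoc, ← mul_div_assoc, ← add_div, div_eq_iff hR.ne']
    linear_combination 4 * hcs - hR2
  linear_combination (1 / 12 * r) * key

theorem heisenbergGate_mul_eq (θ r : ℝ) :
    heisenbergGate θ * blockHom ((r : ℂ), 1) = blockHom (heisenbergPair θ r) := by
  rw [heisenbergGate_eq, ← map_mul, heisenbergPair]
  congr 1
  ext <;> simp

theorem krausMap_mixedKraus (w : ℂ × ℂ) (s : ℝ)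
    (ρ : Matrix (Fin 2 × Fin 2) (Fin 2 × Fin 2) ℂ) :
    krausMap (mixedKraus w s) ρ = traceProbe (blockHom w * ρ * (blockHom w)ᴴ) +
      universalNot (((s : ℂ) • proj₁) * ρ * ((s : ℂ) • proj₁)ᴴ) := by
  rw [traceProbe_eq_krausMap, universalNot_eq_krausMap]
  simp only [krausMap, mixedKraus, Fintype.sum_sum_type, Sum.elim_inl, Sum.elim_inr]
  congr 1
  refine Finset.sum_congr rfl fun m _ => ?_
  have h : (s : ℂ) • unotKraus m = unotKraus m * ((s : ℂ) • proj₁) := by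
    rw [Matrix.mul_smul, unotKraus_mul_proj₁]
  rw [h, conjTranspose_mul]
  simp only [Matrix.mul_assoc]

theorem heisenbergChannel_eq (θ : ℝ) :
    heisenbergChannel θ = krausMap (mixedKraus (heisenbergPair θ 1) 0) := by
  funext ρ
  have h := heisenbergGate_mul_eq θ 1
  rw [Complex.ofReal_one, ← Prod.one_eq_mk, map_one, Matrix.mul_one] at h
  rw [krausMap_mixedKraus, heisenbergChannel, h, universalNot_eq_krausMap]
  simp [krausMap]

theorem measYes_eq (θ : ℝ) : measYes θ = blockHom ((√(1 - 4 / 3 * alpha θ) : ℂ), 1) := by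
  rw [measYes, blockHom_apply, one_smul]

theorem measNo_eq (θ : ℝ) : measNo θ = blockHom ((√(4 / 3 * alpha θ) : ℂ), 0) := by
  rw [measNo, blockHom_apply, zero_smul, add_zero]

theorem measuredChannel_eq (θ : ℝ) : measuredChannel θ = krausMap
    (mixedKraus (heisenbergPair θ √(1 - 4 / 3 * alpha θ)) √(4 / 3 * alpha θ)) := by
  funext ρ
  rw [krausMap_mixedKraus, measuredChannel, heisenbergChannel, ← heisenbergGate_mul_eq,
    ← measYes_eq, measNo, conjTranspose_mul]
  simp only [Matrix.mul_assoc]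

/-! ### The coefficient of the measurement -/

theorem cos_criticalDistance : Real.cos criticalDistance = (4 + √7) / 9 := by
  have h7 : √7 ≤ 3 := Real.sqrt_le_iff.mpr (by norm_num)
  exact Real.cos_arccos (by linarith [Real.sqrt_nonneg 7]) (by linarith)

theorem cos_eq_neg_cos_abs (θ : ℝ) : Real.cos θ = -Real.cos |θ - Real.pi| := by
  rw [Real.cos_abs, Real.cos_sub_pi, neg_neg]

theorem criticalDistance_mem : criticalDistance ∈ Set.Icc 0 Real.pi :=
  ⟨Real.arccos_nonneg _, Real.arccos_le_pi _⟩

theorem abs_sub_pi_mem {θ : ℝ} (hθ : θ ∈ Set.Ico 0 (2 * Real.pi)) :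
    |θ - Real.pi| ∈ Set.Icc 0 Real.pi :=
  ⟨abs_nonneg _, abs_le.mpr ⟨by linarith [hθ.1], by linarith [hθ.2]⟩⟩

theorem cos_lt_cos_of_abs_sub_pi_lt {θ θ' : ℝ} (hθ : |θ - Real.pi| ≤ Real.pi)
    (h : |θ' - Real.pi| < |θ - Real.pi|) : Real.cos θ' < Real.cos θ := by
  rw [cos_eq_neg_cos_abs θ, cos_eq_neg_cos_abs θ']
  exact neg_lt_neg (Real.cos_lt_cos_of_nonneg_of_le_pi (abs_nonneg _) hθ h)

section Alpha

variable {θ : ℝ}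

theorem cos_lt_of_le (h : Real.cos θ ≤ -((4 + √7) / 9)) : 1 + 2 * Real.cos θ < 0 := by
  have h7 : 2 ≤ √7 := Real.le_sqrt_of_sq_le (by norm_num)
  linarith

theorem alpha_nonneg (h : Real.cos θ ≤ -((4 + √7) / 9)) : 0 ≤ alpha θ := by
  have h7 := Real.sq_sqrt (by norm_num : (0 : ℝ) ≤ 7)
  refine div_nonneg ?_ (by positivity)
  nlinarith [Real.sqrt_nonneg 7]

theorem alpha_le (h : Real.cos θ ≤ -((4 + √7) / 9)) : alpha θ ≤ 2 / 3 := by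
  have h1 := cos_lt_of_le h
  rw [alpha, div_le_iff₀ (by nlinarith)]
  nlinarith [Real.cos_sq_le_one θ]

theorem alpha_eq_zero_iff (h : Real.cos θ ≤ -((4 + √7) / 9)) :
    alpha θ = 0 ↔ Real.cos θ = -((4 + √7) / 9) := by
  have h7 := Real.sq_sqrt (by norm_num : (0 : ℝ) ≤ 7)
  have h1 := (cos_lt_of_le h).ne
  rw [alpha, div_eq_zero_iff, or_iff_left (by positivity)]
  constructor
  · intro h2
    have h3 : (9 * Real.cos θ + 4 - √7) * (9 * Real.cos θ + 4 + √7) = 0 := by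
      linear_combination 9 * h2 - h7
    rcases mul_eq_zero.mp h3 with h4 | h4
    · linarith [Real.sqrt_nonneg 7]
    · linarith
  · intro h2
    rw [h2]
    linear_combination h7 / 9

theorem alpha_eq_two_thirds_iff (h : Real.cos θ ≤ -((4 + √7) / 9)) :
    alpha θ = 2 / 3 ↔ Real.cos θ = -1 := by
  have h1 := (cos_lt_of_le h).ne
  have h2 := cos_lt_of_le h
  rw [alpha, div_eq_div_iff (by positivity) (by norm_num)]
  constructor
  · intro h2
    have h3 : (Real.cos θ + 1) * (Real.cos θ - 1) = 0 := by linear_combination h2 / 3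
    rcases mul_eq_zero.mp h3 with h4 | h4 <;> linarith
  · intro h2
    rw [h2]
    norm_num

/-- In terms of v = -(1 + 2cos θ) one has α = 3/4 + 1/(6v) - 1/(4v²), which increases for 0 < v < 3;
here 0 < v ≤ 1. -/
theorem alpha_lt_alpha {θ' : ℝ} (h : 1 + 2 * Real.cos θ < 0) (hlt : Real.cos θ' < Real.cos θ) :
    alpha θ < alpha θ' := by
  have h' : 1 + 2 * Real.cos θ' < 0 := by linarith
  have hb := Real.neg_one_le_cos θ'
  have hne := h.ne
  have hne' := h'.ne
  rw [alpha, alpha, div_lt_div_iff₀ (by positivity) (by positivity)]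
  generalize Real.cos θ = c at *
  generalize Real.cos θ' = d at *
  -- Up to a positive factor this is the difference of the two values of α after clearing
  -- denominators. The second factor is positive since v, v' ≤ 1 gives 2vv' < 3(v + v').
  have key : 0 < (c - d) * (3 * (-(1 + 2 * c) + -(1 + 2 * d)) -
      2 * (-(1 + 2 * c)) * (-(1 + 2 * d))) :=
    mul_pos (by linarith) (by nlinarith)
  nlinarith

/-- This is the stationary point r of the quadratic in `fidelity₁_heisenbergPair`, whose leading
coefficient is negative when 1 + 2cos θ < 0. -/
theorem one_sub_alpha (h : 1 + 2 * Real.cos θ < 0) : √(1 - 4 / 3 * alpha θ) =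
    √(5 + 4 * Real.cos θ) / (-(3 * (1 + 2 * Real.cos θ))) := by
  have hpos : 0 ≤ -(3 * (1 + 2 * Real.cos θ)) := by linarith
  rw [← Real.sqrt_sq hpos, ← Real.sqrt_div (by linarith [Real.neg_one_le_cos θ]), alpha]
  congr 1
  have hne := h.ne
  clear hpos h
  generalize hu : 1 + 2 * Real.cos θ = u at *
  have hc : Real.cos θ = (u - 1) / 2 := by linarith
  rw [hc]
  field_simp
  ring

end Alpha

/-! ### Attained fidelities and properties of the measurement. -/

theorem fidelity₁_heisenbergChannel {θ : ℝ} (hθ : θ ∈ Set.Ico 0 (2 * Real.pi)) :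
    fidelity₁ θ (heisenbergChannel θ) = fidelityFar θ := by
  have hc : Real.cos (θ / 2) ^ 2 = (1 + Real.cos θ) / 2 := by
    rw [Real.cos_sq, mul_div_cancel₀ θ two_ne_zero]; ring
  rw [heisenbergChannel_eq, fidelity₁_heisenbergPair hθ (by norm_num), fidelityFar, hc,
    show 1 + 8 * ((1 + Real.cos θ) / 2) = 5 + 4 * Real.cos θ by ring]
  ring

theorem meas_sq_add_sq {θ : ℝ} (h : Real.cos θ ≤ -((4 + √7) / 9)) :
    √(1 - 4 / 3 * alpha θ) ^ 2 + √(4 / 3 * alpha θ) ^ 2 = 1 := by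
  rw [Real.sq_sqrt (by linarith [alpha_le h]), Real.sq_sqrt (by linarith [alpha_nonneg h])]
  ring

theorem fidelity₁_measuredChannel {θ : ℝ} (hθ : θ ∈ Set.Ico 0 (2 * Real.pi))
    (h : Real.cos θ ≤ -((4 + √7) / 9)) :
    fidelity₁ θ (measuredChannel θ) = fidelityNear θ := by
  have hR2 := Real.sq_sqrt (by linarith [Real.neg_one_le_cos θ] : 0 ≤ 5 + 4 * Real.cos θ)
  have hne := (cos_lt_of_le h).ne
  rw [measuredChannel_eq, fidelity₁_heisenbergPair hθ (meas_sq_add_sq h),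
    one_sub_alpha (cos_lt_of_le h), fidelityNear]
  clear h hθ
  generalize √(5 + 4 * Real.cos θ) = x at *
  generalize hu : 1 + 2 * Real.cos θ = u at *
  have hc : Real.cos θ = (u - 1) / 2 := by linarith
  rw [hc] at hR2 ⊢
  have e1 : 9 * (x / -(3 * u)) ^ 2 = (5 + 4 * ((u - 1) / 2)) / u ^ 2 := by
    rw [← hR2]; field_simp; ring
  have e2 : 3 * (x / -(3 * u)) * x = -(5 + 4 * ((u - 1) / 2)) / u := by
    rw [← hR2]; field_simp
  rw [e1, e2]
  field_simp
  ring

theorem meas_complete {θ : ℝ} (h : Real.cos θ ≤ -((4 + √7) / 9)) :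
    (measYes θ)ᴴ * measYes θ + (measNo θ)ᴴ * measNo θ = 1 := by
  have hs : (√(1 - 4 / 3 * alpha θ) : ℂ) ^ 2 + (√(4 / 3 * alpha θ) : ℂ) ^ 2 = 1 := by
    exact_mod_cast meas_sq_add_sq h
  rw [measYes_eq, measNo_eq, blockHom_conjTranspose_mul, blockHom_conjTranspose_mul, ← map_add,
    ← map_one blockHom]
  congr 1
  ext1
  · simpa [pow_two] using hs
  · simp

theorem not_isIdempotentElem_blockHom {x : ℝ} (h0 : x ≠ 0) (h1 : x ≠ 1) (y : ℂ) :
    ¬ IsIdempotentElem (blockHom ((x : ℂ), y)) := by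
  intro h
  rw [IsIdempotentElem, ← map_mul] at h
  have h2 := congrFun₂ h (0, 0) (0, 0)
  simp only [blockHom_entry, Prod.mk_mul_mk] at h2
  have h3 : x * (x - 1) = 0 := by
    have : (x : ℂ) * (x - 1) = 0 := by
      simp at h2
      linear_combination h2
    exact_mod_cast this
  rcases mul_eq_zero.mp h3 with h4 | h4
  · exact h0 h4
  · exact h1 (by linarith)

/-- On the triplet the two effects have eigenvalues 1 - 4α/3 and 4α/3, and 0 < α ≤ 2/3 keeps both
strictly between 0 and 1. -/
theorem meas_not_projective {θ : ℝ} (h : Real.cos θ ≤ -((4 + √7) / 9)) (hpos : alpha θ ≠ 0) :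
    ¬ IsIdempotentElem ((measYes θ)ᴴ * measYes θ) ∧
      ¬ IsIdempotentElem ((measNo θ)ᴴ * measNo θ) := by
  have ha := lt_of_le_of_ne (alpha_nonneg h) hpos.symm
  have hb := alpha_le h
  have e1 : star (√(1 - 4 / 3 * alpha θ) : ℂ) * √(1 - 4 / 3 * alpha θ) =
      ((1 - 4 / 3 * alpha θ : ℝ) : ℂ) := by
    rw [Complex.star_def, Complex.conj_ofReal, ← Complex.ofReal_mul,
      Real.mul_self_sqrt (by linarith)]
  have e2 : star (√(4 / 3 * alpha θ) : ℂ) * √(4 / 3 * alpha θ) =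
      ((4 / 3 * alpha θ : ℝ) : ℂ) := by
    rw [Complex.star_def, Complex.conj_ofReal, ← Complex.ofReal_mul,
      Real.mul_self_sqrt (by linarith)]
  rw [measYes_eq, measNo_eq, blockHom_conjTranspose_mul, blockHom_conjTranspose_mul, e1, e2]
  exact ⟨not_isIdempotentElem_blockHom (by linarith) (by linarith) _,
    not_isIdempotentElem_blockHom (by linarith) (by linarith) _⟩

end RotationLearning

end

/-! ### Assembly of the theorem. -/

open RotationLearning
theorem mainTheorem8 (θ : ℝ) (hθ : θ ∈ Set.Ico 0 (2 * Real.pi)) :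
    (criticalDistance < |θ - Real.pi| →
      (IsOptimal₁ θ (heisenbergChannel θ) ∧
        fidelity₁ θ (heisenbergChannel θ) = fidelityFar θ) ∧
      (IsOptimal₂ θ (trivialAuxState ketUp) (trivialAuxMap (heisenbergChannel θ)) ∧
        fidelity₂ θ (trivialAuxState ketUp) (trivialAuxMap (heisenbergChannel θ)) =
          fidelityFar θ)) ∧
    (|θ - Real.pi| ≤ criticalDistance →
      (IsOptimal₁ θ (measuredChannel θ) ∧
        fidelity₁ θ (measuredChannel θ) = fidelityNear θ) ∧
      (IsOptimal₂ θ (trivialAuxState ketUp) (trivialAuxMap (measuredChannel θ)) ∧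
        fidelity₂ θ (trivialAuxState ketUp) (trivialAuxMap (measuredChannel θ)) =
          fidelityNear θ) ∧
      (0 ≤ alpha θ ∧ alpha θ ≤ 2 / 3) ∧
      (alpha θ = 0 ↔ |θ - Real.pi| = criticalDistance) ∧
      (alpha θ = 2 / 3 ↔ θ = Real.pi) ∧
      (∀ θ' : ℝ, |θ' - Real.pi| < |θ - Real.pi| → alpha θ < alpha θ') ∧
      (measYes θ)ᴴ * measYes θ + (measNo θ)ᴴ * measNo θ = 1 ∧
      (|θ - Real.pi| < criticalDistance →
        ¬ IsIdempotentElem ((measYes θ)ᴴ * measYes θ) ∧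
        ¬ IsIdempotentElem ((measNo θ)ᴴ * measNo θ))) := by
  have hmem := abs_sub_pi_mem hθ
  refine ⟨fun h => ?_, fun h => ?_⟩
  · have hc : -((4 + √7) / 9) ≤ Real.cos θ := by
      rw [← cos_criticalDistance, cos_eq_neg_cos_abs θ]
      exact neg_le_neg (Real.cos_le_cos_of_nonneg_of_le_pi criticalDistance_mem.1 hmem.2 h.le)
    -- Evenness turns the bound at -θ, needed for the |1⟩ block of the probe, into the same bound.
    have hfar : ∀ x : ℝ, fidelityFar (-x) = fidelityFar x := fun x => by
      simp [fidelityFar, neg_div]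
    have hC : IsChannel (heisenbergChannel θ) := by
      rw [heisenbergChannel_eq]
      exact isChannel_heisenbergPair θ (by norm_num)
    refine optimal_of_fidelity₁_eq (fun t J hJ => hJ.re_averageScore_le_fidelityFar hc)
      (fun t J hJ => ?_) hC (fidelity₁_heisenbergChannel hθ)
    rw [← hfar θ]
    exact hJ.re_averageScore_le_fidelityFar (by rwa [Real.cos_neg])
  · have hc : Real.cos θ ≤ -((4 + √7) / 9) := by
      rw [← cos_criticalDistance, cos_eq_neg_cos_abs θ]
      exact neg_le_neg (Real.cos_le_cos_of_nonneg_of_le_pi hmem.1 criticalDistance_mem.2 h)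
    have hnear : fidelityNear (-θ) = fidelityNear θ := by simp [fidelityNear]
    have hC : IsChannel (measuredChannel θ) := by
      rw [measuredChannel_eq]
      exact isChannel_heisenbergPair θ (meas_sq_add_sq hc)
    have hopt := optimal_of_fidelity₁_eq
      (fun t J hJ => hJ.re_averageScore_le_fidelityNear hc)
      (fun t J hJ => by
        rw [← hnear]
        exact hJ.re_averageScore_le_fidelityNear (by rwa [Real.cos_neg]))
      hC (fidelity₁_measuredChannel hθ hc)
    have hzero : alpha θ = 0 ↔ |θ - Real.pi| = criticalDistance := by
      rw [alpha_eq_zero_iff hc, ← cos_criticalDistance, cos_eq_neg_cos_abs θ, neg_inj]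
      exact Real.injOn_cos.eq_iff hmem criticalDistance_mem
    refine ⟨hopt.1, hopt.2, ⟨alpha_nonneg hc, alpha_le hc⟩, hzero, ?_, fun θ' h' => ?_,
      meas_complete hc, fun hlt => meas_not_projective hc fun h0 => hlt.ne (hzero.mp h0)⟩
    · rw [alpha_eq_two_thirds_iff hc, cos_eq_neg_cos_abs θ, neg_inj, ← Real.cos_zero,
        Real.injOn_cos.eq_iff hmem ⟨le_rfl, Real.pi_pos.le⟩, abs_eq_zero, sub_eq_zero]
    · exact alpha_lt_alpha (cos_lt_of_le hc) (cos_lt_cos_of_abs_sub_pi_lt hmem.2 h')
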